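/- Let $\Gamma$ be a connected compact metric graph: finitely many edges $E_n=[a_n,b_n]$ with $a_n<b_n$, whose end points are glued together at finitely many vertices (loops and parallel edges are allowed). Its standard Laplacian $L^{\rm st}(\Gamma)$ is the operator $-\frac{d^2}{dx^2}$ in $L_2(\Gamma)=\bigoplus_n L_2(E_n)$, defined on the functions that belong to $W_2^2(E_n)$ on every edge, are continuous at every vertex, and whose normal derivatives sum to zero at every vertex. Functions are real-valued, and $0=\lambda_0(\Gamma)\le\lambda_1(\Gamma)\le\lambda_2(\Gamma)\le\dots$ are the eigenvalues of $L^{\rm st}(\Gamma)$, counted with multiplicity. Let $x^*\in(a,b)$ be an interior point of an edge $[a,b]$ of $\Gamma$, and let $\Gamma^*$ be the metric graph obtained by cutting this edge at $x^*$: the edge $[a,b]$ is replaced by two edges $[a,x_1^*]$ and $[x_2^*,b]$ with $x_1^*=x_2^*=x^*$ as real numbers, $a$ and $b$ stay attached to the same vertices as before, and two new vertices of degree one, $V_1^*=\{x_1^*\}$ and $V_2^*=\{x_2^*\}$, are added. Assume that $\Gamma^*$ is connected as well. Then $\lambda_1(\Gamma)$ and $\lambda_1(\Gamma^*)$ are well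 defined (each is the least number $t$ for which there are two linearly independent eigenfunctions with eigenvalues $\le t$), and: 1. $\lambda_1(\Gamma^*)\le\lambda_1(\Gamma)$. 2. If $\lambda_1(\Gamma^*)=\lambda_1(\Gamma)$, then every eigenfunction $\psi_1$ of $L^{\rm st}(\Gamma)$ with eigenvalue $\lambda_1(\Gamma)$ satisfies $\psi_1'(x^*)=0$. If at least one eigenfunction $\psi_1^*$ of $L^{\rm st}(\Gamma^*)$ with eigenvalue $\lambda_1(\Gamma^*)$ satisfies $\psi_1^*(V_1^*)=\psi_1^*(V_2^*)$, then $\lambda_1(\Gamma^*)=\lambda_1(\Gamma)$. -/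

import Mathlib

open Set MeasureTheory

/-- `u ∈ W₂²(a, b)`, expressed through the continuous representative: `u` is differentiable on the
compact interval `[a, b]` (one-sidedly at the end points), `u'` is absolutely continuous on `[a, b]`,
and `u''` (which exists almost everywhere) is square integrable. -/
structure IsW22 (a b : ℝ) (u : ℝ → ℝ) : Prop where
  differentiableOn : DifferentiableOn ℝ u (Icc a b)
  absolutelyContinuous : AbsolutelyContinuousOnInterval (derivWithin u (Icc a b)) a b
  memLp : MemLp (derivWithin (derivWithin u (Icc a b)) (Icc a b)) 2 (volume.restrict (Icc a b))

/-- A compact metric graph with edges indexed by `E` (finite wherever it matters) and vertices `V`.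
Every edge is a compact interval `[left e, right e]` of positive length; its end points are `(e, false)`
(left) and `(e, true)` (right), and `vert` says at which vertex an end point is attached, so that a
vertex is a nonempty class of glued end points. Loops and parallel edges are allowed. -/
structure MetricGraph (V : Type*) (E : Type*) where
  left : E → ℝ
  right : E → ℝ
  left_lt_right : ∀ e, left e < right e
  vert : E × Bool → V
  vert_surjective : Function.Surjective vert

namespace MetricGraph

/-- Any two vertices are joined by a chain of edges. -/
def IsConnected {V E : Type*} (Γ : MetricGraph V E) : Prop :=
  Nonempty V ∧
    ∀ v w : V, Relation.EqvGen (fun p q ↦ ∃ e, Γ.vert (e, false) = p ∧ Γ.vert (e, true) = q) v w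

/-- Real functions on the disjoint union of the closed edges. -/
abbrev Fun {V E : Type*} (Γ : MetricGraph V E) : Type _ :=
  (e : E) → Icc (Γ.left e) (Γ.right e) → ℝ

/-- The restriction of `u` to the edge `e`, as a function of a real variable. It is extended
constantly outside `[left e, right e]`; only its values on the edge are used below. -/
noncomputable def onEdge {V E : Type*} (Γ : MetricGraph V E) (u : Γ.Fun) (e : E) : ℝ → ℝ :=
  IccExtend (Γ.left_lt_right e).le (u e)

/-- The first derivative along the edge `e` (one-sided at the end points). -/
noncomputable def deriv₁ {V E : Type*} (Γ : MetricGraph V E) (u : Γ.Fun) (e : E) : ℝ → ℝ :=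
  derivWithin (Γ.onEdge u e) (Icc (Γ.left e) (Γ.right e))

/-- The second derivative along the edge `e`. -/
noncomputable def deriv₂ {V E : Type*} (Γ : MetricGraph V E) (u : Γ.Fun) (e : E) : ℝ → ℝ :=
  derivWithin (Γ.deriv₁ u e) (Icc (Γ.left e) (Γ.right e))

/-- The coordinate of an end point of an edge. -/
def coord {V E : Type*} (Γ : MetricGraph V E) : E × Bool → ℝ
  | (e, false) => Γ.left e
  | (e, true) => Γ.right e

/-- The value of `u` at an end point of an edge. -/
noncomputable def endValue {V E : Type*} (Γ : MetricGraph V E) (u : Γ.Fun) (p : E × Bool) : ℝ :=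
  Γ.onEdge u p.1 (Γ.coord p)

/-- The normal derivative of `u` at an end point of an edge, pointing into the edge. -/
noncomputable def normalDeriv {V E : Type*} (Γ : MetricGraph V E) (u : Γ.Fun) : E × Bool → ℝ
  | (e, false) => Γ.deriv₁ u e (Γ.left e)
  | (e, true) => -Γ.deriv₁ u e (Γ.right e)

/-- The domain of the standard Laplacian: `u` is in `W₂²` on every edge, it is continuous at every
vertex, and at every vertex the sum of the normal derivatives is zero. -/
structure InDomain {V E : Type*} [DecidableEq V] [Fintype E] (Γ : MetricGraph V E) (u : Γ.Fun) :
    Prop where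
  sobolev : ∀ e, IsW22 (Γ.left e) (Γ.right e) (Γ.onEdge u e)
  continuous : ∀ p q : E × Bool, Γ.vert p = Γ.vert q → Γ.endValue u p = Γ.endValue u q
  kirchhoff : ∀ v : V, ∑ p : E × Bool with Γ.vert p = v, Γ.normalDeriv u p = 0

/-- `u` is an eigenfunction of the standard Laplacian `-d²/dx²` with eigenvalue `μ`; the equation
`-u'' = μ u` is an equality in `L₂`. -/
structure IsEigenfunction {V E : Type*} [DecidableEq V] [Fintype E] (Γ : MetricGraph V E) (μ : ℝ)
    (u : Γ.Fun) : Prop where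
  ne_zero : u ≠ 0
  inDomain : Γ.InDomain u
  equation : ∀ e, ∀ᵐ x ∂volume.restrict (Icc (Γ.left e) (Γ.right e)),
    -Γ.deriv₂ u e x = μ * Γ.onEdge u e x

/-- The numbers `t` such that at least `n + 1` eigenvalues, counted with multiplicity, are `≤ t`. -/
def eigenvalueBounds {V E : Type*} [DecidableEq V] [Fintype E] (Γ : MetricGraph V E) (n : ℕ) :
    Set ℝ :=
  {t | ∃ φ : Fin (n + 1) → Γ.Fun, LinearIndependent ℝ φ ∧
    ∀ i, ∃ μ ≤ t, Γ.IsEigenfunction μ (φ i)}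

/-- The eigenvalue `λ_n` of the standard Laplacian in the list `λ₀ ≤ λ₁ ≤ λ₂ ≤ …` of all
eigenvalues, repeated according to multiplicity. -/
noncomputable def eigenvalue {V E : Type*} [DecidableEq V] [Fintype E] (Γ : MetricGraph V E)
    (n : ℕ) : ℝ :=
  sInf (Γ.eigenvalueBounds n)

/-- The graph obtained by cutting the edge `e₀` at the interior point `x`. The edge `e₀` is replaced
by `[left e₀, x]` (index `some e₀`) and `[x, right e₀]` (index `none`), and there are two new
vertices: `Sum.inr false`, consisting of the right end point of the first piece, and `Sum.inr true`,
consisting of the left end point of the second piece. -/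
def cut {V E : Type*} [DecidableEq E] (Γ : MetricGraph V E) (e₀ : E) (x : ℝ)
    (hx : x ∈ Ioo (Γ.left e₀) (Γ.right e₀)) : MetricGraph (V ⊕ Bool) (Option E) where
  left
    | some e => Γ.left e
    | none => x
  right
    | some e => if e = e₀ then x else Γ.right e
    | none => Γ.right e₀
  left_lt_right := by
    rintro (_ | e)
    · exact hx.2
    · by_cases h : e = e₀
      · subst h
        simpa using hx.1
      · simpa [h] using Γ.left_lt_right e
  vert
    | (some e, false) => Sum.inl (Γ.vert (e, false))
    | (some e, true) => if e = e₀ then Sum.inr false else Sum.inl (Γ.vert (e, true))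
    | (none, false) => Sum.inr true
    | (none, true) => Sum.inl (Γ.vert (e₀, true))
  vert_surjective := by
    rintro (v | _ | _)
    · obtain ⟨⟨e, _ | _⟩, rfl⟩ := Γ.vert_surjective v
      · exact ⟨(some e, false), rfl⟩
      · by_cases h : e = e₀
        · subst h
          exact ⟨(none, true), rfl⟩
        · exact ⟨(some e, true), by simp [h]⟩
    · exact ⟨(some e₀, true), by simp⟩
    · exact ⟨(none, false), rfl⟩

end MetricGraph

/-! On a connected graph $\lambda_1$ is the minimum of the Rayleigh quotient $\int|u'|^2/\int|u|^2$
over nonzero functions of mean value zero that are $W_2^1$ on the edges and continuous at the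
vertices, and its minimizers are eigenfunctions (`IsConnected.eigenvalue_one`,
`weak_eigenfunction_of_minimizer`, `isEigenfunction_of_weak`). Neither the norm, nor the energy, nor
the mean value sees a single point, so cutting at $x^*$ only removes the continuity condition there:
the form domain of $\Gamma$ sits inside that of $\Gamma^*$ as the functions with equal values at the
two new vertices (`InFormDomain.cut`, `InFormDomain.glue`).

All claims follow. The larger domain has the smaller minimum. If the minima agree, an eigenfunction
$\psi_1$ of $\Gamma$ also minimizes on $\Gamma^*$, hence is an eigenfunction there, and the
Kirchhoff condition at a vertex of degree one is $\psi_1'(x^*)=0$. If some $\psi_1^*$ takes equal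
values at the new vertices, it glues to a trial function on $\Gamma$ with quotient
$\lambda_1(\Gamma^*)$, which gives the reverse inequality.

The variational principle is proved by the direct method: a minimizing sequence converges uniformly
along a subsequence by Arzelà–Ascoli, and the parallelogram identity makes its derivatives converge
in $L_2$. -/

open Filter Topology

/-- `g ∈ L₂(a, b)` is the weak derivative of `f` on `[a, b]`. -/
def HasWeakDeriv (a b : ℝ) (f g : ℝ → ℝ) : Prop :=
  MemLp g 2 (volume.restrict (Icc a b)) ∧ ∀ x ∈ Icc a b, f x = f a + ∫ t in a..x, g t

/-! ### Weak derivatives on an interval -/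

section Interval

variable {a b : ℝ} {f g h k : ℝ → ℝ}

theorem intervalIntegrable_of_integrable_restrict_Icc (hab : a ≤ b)
    (hg : Integrable g (volume.restrict (Icc a b))) : IntervalIntegrable g volume a b :=
  (intervalIntegrable_iff_integrableOn_Icc_of_le hab).2 hg

theorem intervalIntegrable_of_memLp_two (hab : a ≤ b)
    (hg : MemLp g 2 (volume.restrict (Icc a b))) : IntervalIntegrable g volume a b :=
  intervalIntegrable_of_integrable_restrict_Icc hab (hg.integrable (by norm_num))

theorem intervalIntegrable_mul_of_memLp_two (hab : a ≤ b)
    (hg : MemLp g 2 (volume.restrict (Icc a b))) (hh : MemLp h 2 (volume.restrict (Icc a b))) :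
    IntervalIntegrable (fun x ↦ g x * h x) volume a b :=
  intervalIntegrable_of_integrable_restrict_Icc hab (hg.integrable_mul hh)

theorem memLp_two_of_continuousOn (hg : ContinuousOn g (Icc a b)) :
    MemLp g 2 (volume.restrict (Icc a b)) := by
  obtain ⟨C, hC⟩ := isCompact_Icc.exists_bound_of_continuousOn hg
  exact MemLp.of_bound (hg.aestronglyMeasurable measurableSet_Icc) C
    ((ae_restrict_iff' measurableSet_Icc).2 (.of_forall hC))

/-- The Cauchy–Schwarz inequality for a function and a constant. -/
theorem sq_intervalIntegral_le (hab : a ≤ b) (hg : MemLp g 2 (volume.restrict (Icc a b))) :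
    (∫ t in a..b, g t) ^ 2 ≤ (b - a) * ∫ t in a..b, g t * g t := by
  rcases hab.eq_or_lt with rfl | hlt
  · simp
  set I := ∫ t in a..b, g t with hI
  have hg1 := intervalIntegrable_of_memLp_two hab hg
  have hg2 := intervalIntegrable_mul_of_memLp_two hab hg hg
  -- The variance of `g` around its mean value `I / (b - a)` is nonnegative; expanding the square
  -- gives the inequality.
  have h0 : 0 ≤ ∫ t in a..b, (g t - I / (b - a)) * (g t - I / (b - a)) :=
    intervalIntegral.integral_nonneg hab fun t _ ↦ mul_self_nonneg _
  have h1 : ∫ t in a..b, (g t - I / (b - a)) * (g t - I / (b - a)) =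
      (∫ t in a..b, g t * g t) - 2 * (I / (b - a)) * I + (b - a) * (I / (b - a)) ^ 2 := by
    have : ∀ t, (g t - I / (b - a)) * (g t - I / (b - a)) =
        (g t * g t - 2 * (I / (b - a)) * g t) + (I / (b - a)) ^ 2 := fun t ↦ by ring
    simp_rw [this]
    rw [intervalIntegral.integral_add (hg2.sub (hg1.const_mul _)) (by simp),
      intervalIntegral.integral_sub hg2 (hg1.const_mul _), intervalIntegral.integral_const_mul]
    simp [hI]
  rw [h1] at h0
  have hpos : 0 < b - a := sub_pos.2 hlt
  have h2 : (b - a) * ((∫ t in a..b, g t * g t) - 2 * (I / (b - a)) * I +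
      (b - a) * (I / (b - a)) ^ 2) = (b - a) * (∫ t in a..b, g t * g t) - I ^ 2 := by
    field_simp
    ring
  nlinarith [mul_nonneg hpos.le h0]

/-- Completeness of `L₂(a, b)`, in terms of functions. -/
theorem exists_memLp_two_tendsto_of_cauchy (hab : a ≤ b) {u : ℕ → ℝ → ℝ}
    (hu : ∀ n, MemLp (u n) 2 (volume.restrict (Icc a b)))
    (hc : ∀ ε > 0, ∃ N, ∀ m ≥ N, ∀ n ≥ N,
      ∫ t in a..b, (u m t - u n t) * (u m t - u n t) < ε) :
    ∃ v, MemLp v 2 (volume.restrict (Icc a b)) ∧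
      Tendsto (fun n ↦ ∫ t in a..b, (u n t - v t) * (u n t - v t)) atTop (𝓝 0) := by
  have key : ∀ {w z : ℝ → ℝ} (hw : MemLp w 2 (volume.restrict (Icc a b)))
      (hz : MemLp z 2 (volume.restrict (Icc a b))),
      dist (hw.toLp w) (hz.toLp z) ^ 2 = ∫ t in a..b, (w t - z t) * (w t - z t) := by
    intro w z hw hz
    rw [dist_eq_norm, ← MemLp.toLp_sub, ← real_inner_self_eq_norm_sq, L2.inner_def,
      intervalIntegral.integral_of_le hab, ← integral_Icc_eq_integral_Ioc]
    refine integral_congr_ae ?_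
    filter_upwards [(hw.sub hz).coeFn_toLp] with t ht
    rw [ht]
    simp [sq]
  have hcs : CauchySeq fun n ↦ (hu n).toLp (u n) := by
    rw [Metric.cauchySeq_iff]
    intro ε hε
    obtain ⟨N, hN⟩ := hc (ε ^ 2) (by positivity)
    refine ⟨N, fun m hm n hn ↦ ?_⟩
    have := hN m hm n hn
    rw [← key (hu m) (hu n)] at this
    exact lt_of_pow_lt_pow_left₀ 2 hε.le this
  obtain ⟨v, hv⟩ := cauchySeq_tendsto_of_complete hcs
  refine ⟨v, Lp.memLp v, ?_⟩
  have h2 := (tendsto_iff_dist_tendsto_zero.1 hv).pow 2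
  rw [zero_pow two_ne_zero] at h2
  refine h2.congr fun n ↦ ?_
  rw [← key (hu n) (Lp.memLp v), Lp.toLp_coeFn]

namespace HasWeakDeriv

theorem memLp_deriv (h : HasWeakDeriv a b f g) : MemLp g 2 (volume.restrict (Icc a b)) := h.1

theorem intervalIntegrable (hab : a ≤ b) (h : HasWeakDeriv a b f g) :
    IntervalIntegrable g volume a b :=
  intervalIntegrable_of_memLp_two hab h.1

theorem sub_eq (hab : a ≤ b) (h : HasWeakDeriv a b f g) {x y : ℝ} (hx : x ∈ Icc a b)
    (hy : y ∈ Icc a b) : f y - f x = ∫ t in x..y, g t := by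
  have hi := h.intervalIntegrable hab
  rw [h.2 x hx, h.2 y hy, ← intervalIntegral.integral_interval_sub_left (a := a) (b := y) (c := x)]
  · ring
  · exact hi.mono_set (by rw [uIcc_of_le hab, uIcc_of_le hy.1]; exact Icc_subset_Icc_right hy.2)
  · exact hi.mono_set (by rw [uIcc_of_le hab, uIcc_of_le hx.1]; exact Icc_subset_Icc_right hx.2)

theorem mono (h : HasWeakDeriv a b f g) {c d : ℝ} (hac : a ≤ c) (hcd : c ≤ d) (hdb : d ≤ b) :
    HasWeakDeriv c d f g := by
  refine ⟨h.1.mono_measure (Measure.restrict_mono (Icc_subset_Icc hac hdb) le_rfl),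
    fun x hx ↦ ?_⟩
  rw [← h.sub_eq (hac.trans (hcd.trans hdb)) ⟨hac, hcd.trans hdb⟩
    ⟨hac.trans hx.1, hx.2.trans hdb⟩]
  ring

/-- Cauchy–Schwarz applied to the integral of `g` over `[x, y]`. This Hölder estimate supplies the
equicontinuity for compactness, and shows that zero energy forces constancy on an edge. -/
theorem sq_sub_le (h : HasWeakDeriv a b f g) {x y : ℝ} (hx : x ∈ Icc a b) (hy : y ∈ Icc a b) :
    (f y - f x) ^ 2 ≤ |y - x| * ∫ t in a..b, g t * g t := by
  have hab : a ≤ b := hx.1.trans hx.2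
  wlog hxy : x ≤ y generalizing x y
  · rw [abs_sub_comm, ← neg_sq, neg_sub]
    exact this hy hx (le_of_not_ge hxy)
  have h' := h.mono hx.1 hxy hy.2
  rw [h.sub_eq hab hx hy, abs_of_nonneg (sub_nonneg.2 hxy)]
  refine (sq_intervalIntegral_le hxy h'.1).trans ?_
  refine mul_le_mul_of_nonneg_left ?_ (sub_nonneg.2 hxy)
  exact intervalIntegral.integral_mono_interval hx.1 hxy hy.2
    (.of_forall fun t ↦ mul_self_nonneg (g t)) (intervalIntegrable_mul_of_memLp_two hab h.1 h.1)

/-- The function `f` is arbitrary outside `[a, b]`, so two-sided derivatives at the end points are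
meaningless for it; the primitive `F` is a representative defined on the whole line. -/
theorem exists_absolutelyContinuous (hab : a ≤ b) (h : HasWeakDeriv a b f g) :
    ∃ F : ℝ → ℝ, AbsolutelyContinuousOnInterval F a b ∧ (∀ x ∈ Icc a b, F x = f x) ∧
      ∀ᵐ x, x ∈ uIcc a b → HasDerivAt F (g x) x := by
  have hi := h.intervalIntegrable hab
  refine ⟨fun x ↦ f a + ∫ t in a..x, g t, ?_, fun x hx ↦ (h.2 x hx).symm, ?_⟩
  · have hc : AbsolutelyContinuousOnInterval (fun _ ↦ f a) a b :=
      (LipschitzWith.const (f a)).lipschitzOnWith.absolutelyContinuousOnInterval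
    exact hc.add (hi.absolutelyContinuousOnInterval_intervalIntegral (by simp))
  · filter_upwards [hi.ae_hasDerivAt_integral] with x hx hx'
    exact (hx hx' a (by simp)).const_add _

theorem continuousOn (hab : a ≤ b) (h : HasWeakDeriv a b f g) : ContinuousOn f (Icc a b) := by
  obtain ⟨F, hF, hFf, -⟩ := h.exists_absolutelyContinuous hab
  have := hF.continuousOn
  rw [uIcc_of_le hab] at this
  exact this.congr fun x hx ↦ (hFf x hx).symm

theorem memLp (hab : a ≤ b) (h : HasWeakDeriv a b f g) : MemLp f 2 (volume.restrict (Icc a b)) :=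
  memLp_two_of_continuousOn (h.continuousOn hab)

theorem integral_mul_add_mul (hab : a ≤ b) (hf : HasWeakDeriv a b f g)
    (hh : HasWeakDeriv a b h k) :
    (∫ t in a..b, g t * h t) + ∫ t in a..b, f t * k t = f b * h b - f a * h a := by
  rw [← intervalIntegral.integral_add (intervalIntegrable_mul_of_memLp_two hab hf.1 (hh.memLp hab))
    (intervalIntegrable_mul_of_memLp_two hab (hf.memLp hab) hh.1)]
  obtain ⟨F, hF, hFf, hF'⟩ := hf.exists_absolutelyContinuous hab
  obtain ⟨H, hH, hHh, hH'⟩ := hh.exists_absolutelyContinuous hab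
  have ha : a ∈ Icc a b := ⟨le_rfl, hab⟩
  have hb : b ∈ Icc a b := ⟨hab, le_rfl⟩
  rw [← hFf a ha, ← hFf b hb, ← hHh a ha, ← hHh b hb, ← hF.integral_deriv_mul_eq_sub hH]
  refine intervalIntegral.integral_congr_ae ?_
  filter_upwards [hF', hH'] with x hx hx' hxm
  have hxm' := uIoc_subset_uIcc hxm
  have hxm'' : x ∈ Icc a b := by rwa [uIcc_of_le hab] at hxm'
  rw [(hx hxm').deriv, (hx' hxm').deriv, hFf x hxm'', hHh x hxm'']

theorem congr (h : HasWeakDeriv a b f g) {f' g' : ℝ → ℝ} (hf : EqOn f' f (Icc a b))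
    (hg : ∀ᵐ x ∂volume.restrict (Icc a b), g' x = g x) : HasWeakDeriv a b f' g' := by
  refine ⟨(memLp_congr_ae hg).2 h.1, fun x hx ↦ ?_⟩
  rw [hf hx, hf ⟨le_rfl, hx.1.trans hx.2⟩, h.2 x hx]
  congr 1
  refine intervalIntegral.integral_congr_ae ?_
  rw [ae_restrict_iff' measurableSet_Icc] at hg
  filter_upwards [hg] with t ht htm
  rw [uIoc_of_le hx.1] at htm
  exact (ht ⟨htm.1.le, htm.2.trans hx.2⟩).symm

theorem add (hf : HasWeakDeriv a b f g) (hh : HasWeakDeriv a b h k) :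
    HasWeakDeriv a b (f + h) (g + k) := by
  refine ⟨hf.1.add hh.1, fun x hx ↦ ?_⟩
  have h1 := (hf.mono le_rfl hx.1 hx.2).intervalIntegrable hx.1
  have h2 := (hh.mono le_rfl hx.1 hx.2).intervalIntegrable hx.1
  simp only [Pi.add_apply]
  rw [intervalIntegral.integral_add h1 h2, hf.2 x hx, hh.2 x hx]
  ring

theorem const_smul (c : ℝ) (hf : HasWeakDeriv a b f g) : HasWeakDeriv a b (c • f) (c • g) := by
  refine ⟨hf.1.const_smul c, fun x hx ↦ ?_⟩
  simp only [Pi.smul_apply, smul_eq_mul]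
  rw [intervalIntegral.integral_const_mul, hf.2 x hx]
  ring

theorem const (c : ℝ) : HasWeakDeriv a b (fun _ ↦ c) (fun _ ↦ 0) :=
  ⟨MemLp.zero', fun _ _ ↦ by simp⟩

theorem of_hasDerivWithinAt (hf : ∀ x ∈ Icc a b, HasDerivWithinAt f (g x) (Icc a b) x)
    (hg : ContinuousOn g (Icc a b)) : HasWeakDeriv a b f g := by
  refine ⟨memLp_two_of_continuousOn hg, fun x hx ↦ ?_⟩
  have hsub : Icc a x ⊆ Icc a b := Icc_subset_Icc_right hx.2
  rw [intervalIntegral.integral_eq_sub_of_hasDerivAt_of_le hx.1 (f := f)]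
  · ring
  · exact fun y hy ↦ (hf y (hsub hy)).continuousWithinAt.mono hsub
  · exact fun y hy ↦ (hf y (hsub (Ioo_subset_Icc_self hy))).hasDerivAt
      (Icc_mem_nhds hy.1 (hy.2.trans_le hx.2))
  · exact (hg.mono hsub).intervalIntegrable_of_Icc hx.1

theorem hasDerivWithinAt (hf : HasWeakDeriv a b f g) (hg : ContinuousOn g (Icc a b)) {x : ℝ}
    (hx : x ∈ Icc a b) : HasDerivWithinAt f (g x) (Icc a b) x := by
  have hab : a ≤ b := hx.1.trans hx.2
  have : HasDerivWithinAt (fun y ↦ f a + ∫ t in a..y, g t) (g x) (Icc a b) x := by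
    refine HasDerivWithinAt.const_add _ ?_
    have : Fact (x ∈ Icc a b) := ⟨hx⟩
    exact intervalIntegral.integral_hasDerivWithinAt_right
      ((hf.mono le_rfl hx.1 hx.2).intervalIntegrable hx.1)
      (hg.stronglyMeasurableAtFilter_nhdsWithin measurableSet_Icc x) (hg x hx)
  exact this.congr (fun y hy ↦ hf.2 y hy) (hf.2 x hx)

theorem union {c : ℝ} (hac : a ≤ c) (hcb : c ≤ b) (h1 : HasWeakDeriv a c f g)
    (h2 : HasWeakDeriv c b f g) : HasWeakDeriv a b f g := by
  have hm : MemLp g 2 (volume.restrict (Icc a b)) := by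
    rw [← Icc_union_Icc_eq_Icc hac hcb]
    have hm := aestronglyMeasurable_union_iff.2 ⟨h1.1.1, h2.1.1⟩
    rw [memLp_two_iff_integrable_sq hm]
    exact IntegrableOn.union (μ := volume) ((memLp_two_iff_integrable_sq h1.1.1).1 h1.1)
      ((memLp_two_iff_integrable_sq h2.1.1).1 h2.1)
  refine ⟨hm, fun x hx ↦ ?_⟩
  rcases le_total x c with hxc | hcx
  · exact h1.2 x ⟨hx.1, hxc⟩
  · rw [h2.2 x ⟨hcx, hx.2⟩, h1.2 c ⟨hac, le_rfl⟩, add_assoc,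
      intervalIntegral.integral_add_adjacent_intervals (h1.intervalIntegrable hac)
        ((h2.mono le_rfl hcx hx.2).intervalIntegrable hcx)]

/-- Weak differentiation is a closed operator: by Cauchy–Schwarz, $L_2$ convergence of the
derivatives gives convergence of their integrals over `[a, x]`, so the integral identity passes to
the limit. -/
theorem of_tendsto (hab : a ≤ b) {u v : ℕ → ℝ → ℝ} (h : ∀ n, HasWeakDeriv a b (u n) (v n))
    (hg : MemLp g 2 (volume.restrict (Icc a b)))
    (hv : Tendsto (fun n ↦ ∫ t in a..b, (v n t - g t) * (v n t - g t)) atTop (𝓝 0))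
    (hu : ∀ x ∈ Icc a b, Tendsto (fun n ↦ u n x) atTop (𝓝 (f x))) : HasWeakDeriv a b f g := by
  refine ⟨hg, fun x hx ↦ ?_⟩
  have hsub : Icc a x ⊆ Icc a b := Icc_subset_Icc_right hx.2
  have hgx : MemLp g 2 (volume.restrict (Icc a x)) :=
    hg.mono_measure (Measure.restrict_mono hsub le_rfl)
  have hlim : Tendsto (fun n ↦ u n x - u n a - ∫ t in a..x, g t) atTop
      (𝓝 (f x - f a - ∫ t in a..x, g t)) :=
    ((hu x hx).sub (hu a ⟨le_rfl, hab⟩)).sub_const _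
  have hbound : ∀ n, (u n x - u n a - ∫ t in a..x, g t) ^ 2 ≤
      (b - a) * ∫ t in a..b, (v n t - g t) * (v n t - g t) := by
    intro n
    have hn := (h n).mono le_rfl hx.1 hx.2
    rw [(h n).2 x hx, add_sub_cancel_left, ← intervalIntegral.integral_sub
      (hn.intervalIntegrable hx.1) (intervalIntegrable_of_memLp_two hx.1 hgx)]
    have hi := intervalIntegrable_mul_of_memLp_two hab ((h n).1.sub hg) ((h n).1.sub hg)
    have hmono : ∫ t in a..x, (v n t - g t) * (v n t - g t) ≤
        ∫ t in a..b, (v n t - g t) * (v n t - g t) :=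
      intervalIntegral.integral_mono_interval le_rfl hx.1 hx.2
        (.of_forall fun t ↦ mul_self_nonneg _) hi
    refine (sq_intervalIntegral_le hx.1 (hn.1.sub hgx)).trans ?_
    exact mul_le_mul (by linarith [hx.2]) hmono
      (intervalIntegral.integral_nonneg hx.1 fun t _ ↦ mul_self_nonneg _) (by linarith)
  have hsq := hlim.pow 2
  have h0 : (f x - f a - ∫ t in a..x, g t) ^ 2 ≤ 0 :=
    le_of_tendsto_of_tendsto' hsq (by simpa using hv.const_mul (b - a)) hbound
  nlinarith [pow_eq_zero_iff (two_ne_zero) |>.1 (le_antisymm h0 (sq_nonneg _))]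

end HasWeakDeriv

end Interval

/-! ### The inner product and the form domain on a graph -/

namespace MetricGraph

variable {V E : Type*} (Γ : MetricGraph V E) {f g h k u v w : E → ℝ → ℝ}

/-- Square integrability on every edge. -/
def SquareIntegrable (u : E → ℝ → ℝ) : Prop :=
  ∀ e, MemLp (u e) 2 (volume.restrict (Icc (Γ.left e) (Γ.right e)))

/-- The inner product of `L₂(Γ)`. -/
noncomputable def edgeInner [Fintype E] (u v : E → ℝ → ℝ) : ℝ :=
  ∑ e, ∫ x in Γ.left e..Γ.right e, u e x * v e x

/-- `f` belongs to the domain of the quadratic form of the standard Laplacian, that is, it is `W₂¹` on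
every edge and continuous at the vertices; `g` is its derivative. -/
structure InFormDomain (f g : E → ℝ → ℝ) : Prop where
  weakDeriv : ∀ e, HasWeakDeriv (Γ.left e) (Γ.right e) (f e) (g e)
  continuous : ∀ p q : E × Bool, Γ.vert p = Γ.vert q → f p.1 (Γ.coord p) = f q.1 (Γ.coord q)

variable {Γ}

theorem left_le_right (e : E) : Γ.left e ≤ Γ.right e := (Γ.left_lt_right e).le

theorem coord_mem (p : E × Bool) : Γ.coord p ∈ Icc (Γ.left p.1) (Γ.right p.1) := by
  rcases p with ⟨e, _ | _⟩
  · exact left_mem_Icc.2 (left_le_right e)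
  · exact right_mem_Icc.2 (left_le_right e)

namespace InFormDomain

theorem squareIntegrable (hf : Γ.InFormDomain f g) : Γ.SquareIntegrable f :=
  fun e ↦ (hf.weakDeriv e).memLp (left_le_right e)

theorem squareIntegrable_deriv (hf : Γ.InFormDomain f g) : Γ.SquareIntegrable g :=
  fun e ↦ (hf.weakDeriv e).memLp_deriv

theorem add (hf : Γ.InFormDomain f g) (hh : Γ.InFormDomain h k) :
    Γ.InFormDomain (f + h) (g + k) :=
  ⟨fun e ↦ (hf.weakDeriv e).add (hh.weakDeriv e), fun p q hpq ↦ by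
    simp only [Pi.add_apply]
    rw [hf.continuous p q hpq, hh.continuous p q hpq]⟩

theorem const_smul (c : ℝ) (hf : Γ.InFormDomain f g) : Γ.InFormDomain (c • f) (c • g) :=
  ⟨fun e ↦ (hf.weakDeriv e).const_smul c, fun p q hpq ↦ by
    simp only [Pi.smul_apply]
    rw [hf.continuous p q hpq]⟩

theorem const (c : ℝ) : Γ.InFormDomain (fun _ _ ↦ c) (fun _ _ ↦ 0) :=
  ⟨fun _ ↦ HasWeakDeriv.const c, fun _ _ _ ↦ rfl⟩

theorem sub (hf : Γ.InFormDomain f g) (hh : Γ.InFormDomain h k) :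
    Γ.InFormDomain (f - h) (g - k) := by
  simpa [sub_eq_add_neg] using hf.add (hh.const_smul (-1))

end InFormDomain

theorem squareIntegrable_const (c : ℝ) : Γ.SquareIntegrable fun _ _ ↦ c :=
  fun _ ↦ memLp_const c

theorem SquareIntegrable.add (hu : Γ.SquareIntegrable u) (hv : Γ.SquareIntegrable v) :
    Γ.SquareIntegrable (u + v) :=
  fun e ↦ (hu e).add (hv e)

theorem SquareIntegrable.sub (hu : Γ.SquareIntegrable u) (hv : Γ.SquareIntegrable v) :
    Γ.SquareIntegrable (u - v) :=
  fun e ↦ (hu e).sub (hv e)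

theorem SquareIntegrable.const_smul (c : ℝ) (hu : Γ.SquareIntegrable u) :
    Γ.SquareIntegrable (c • u) :=
  fun e ↦ (hu e).const_smul c

section Inner

variable [Fintype E]

theorem edgeInner_comm (u v : E → ℝ → ℝ) : Γ.edgeInner u v = Γ.edgeInner v u := by
  simp only [edgeInner, mul_comm]

theorem edgeInner_self_nonneg (u : E → ℝ → ℝ) : 0 ≤ Γ.edgeInner u u :=
  Finset.sum_nonneg fun e _ ↦
    intervalIntegral.integral_nonneg (left_le_right e) fun _ _ ↦ mul_self_nonneg _

theorem edgeInner_add_left (hu : Γ.SquareIntegrable u) (hv : Γ.SquareIntegrable v)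
    (hw : Γ.SquareIntegrable w) :
    Γ.edgeInner (u + v) w = Γ.edgeInner u w + Γ.edgeInner v w := by
  rw [edgeInner, edgeInner, edgeInner, ← Finset.sum_add_distrib]
  refine Finset.sum_congr rfl fun e _ ↦ ?_
  rw [← intervalIntegral.integral_add
    (intervalIntegrable_mul_of_memLp_two (left_le_right e) (hu e) (hw e))
    (intervalIntegrable_mul_of_memLp_two (left_le_right e) (hv e) (hw e))]
  simp only [Pi.add_apply, add_mul]

theorem edgeInner_smul_left (c : ℝ) (u v : E → ℝ → ℝ) :
    Γ.edgeInner (c • u) v = c * Γ.edgeInner u v := by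
  rw [edgeInner, edgeInner, Finset.mul_sum]
  refine Finset.sum_congr rfl fun e _ ↦ ?_
  rw [← intervalIntegral.integral_const_mul]
  simp only [Pi.smul_apply, smul_eq_mul, mul_assoc]

theorem edgeInner_add_smul_left (c : ℝ) (hu : Γ.SquareIntegrable u) (hv : Γ.SquareIntegrable v)
    (hw : Γ.SquareIntegrable w) :
    Γ.edgeInner (u + c • v) w = Γ.edgeInner u w + c * Γ.edgeInner v w := by
  rw [edgeInner_add_left hu (hv.const_smul c) hw, edgeInner_smul_left]

theorem edgeInner_add_smul_self (c : ℝ) (hu : Γ.SquareIntegrable u)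
    (hv : Γ.SquareIntegrable v) :
    Γ.edgeInner (u + c • v) (u + c • v) =
      Γ.edgeInner u u + 2 * c * Γ.edgeInner u v + c ^ 2 * Γ.edgeInner v v := by
  have huv := hu.add (hv.const_smul c)
  rw [edgeInner_add_smul_left c hu hv huv, edgeInner_comm u, edgeInner_comm v,
    edgeInner_add_smul_left c hu hv hu, edgeInner_add_smul_left c hu hv hv, edgeInner_comm v u]
  ring

theorem edgeInner_parallelogram (hu : Γ.SquareIntegrable u) (hv : Γ.SquareIntegrable v) :
    Γ.edgeInner (u + v) (u + v) + Γ.edgeInner (u - v) (u - v) =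
      2 * Γ.edgeInner u u + 2 * Γ.edgeInner v v := by
  have h1 := edgeInner_add_smul_self 1 hu hv
  have h2 := edgeInner_add_smul_self (-1) hu hv
  rw [one_smul] at h1
  rw [neg_one_smul, ← sub_eq_add_neg] at h2
  rw [h1, h2]
  ring

theorem edgeInner_congr {u' v' : E → ℝ → ℝ}
    (hu : ∀ e, ∀ᵐ x ∂volume.restrict (Icc (Γ.left e) (Γ.right e)), u e x = u' e x)
    (hv : ∀ e, ∀ᵐ x ∂volume.restrict (Icc (Γ.left e) (Γ.right e)), v e x = v' e x) :
    Γ.edgeInner u v = Γ.edgeInner u' v' := by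
  refine Finset.sum_congr rfl fun e _ ↦ intervalIntegral.integral_congr_ae ?_
  have h1 := (ae_restrict_iff' measurableSet_Icc).1 (hu e)
  have h2 := (ae_restrict_iff' measurableSet_Icc).1 (hv e)
  filter_upwards [h1, h2] with x hx hx' hm
  rw [uIoc_of_le (left_le_right e)] at hm
  rw [hx (Ioc_subset_Icc_self hm), hx' (Ioc_subset_Icc_self hm)]

theorem ae_eq_zero_of_edgeInner_self (hu : Γ.SquareIntegrable u) (h0 : Γ.edgeInner u u = 0)
    (e : E) : ∀ᵐ x ∂volume.restrict (Icc (Γ.left e) (Γ.right e)), u e x = 0 := by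
  have h1 := (Finset.sum_eq_zero_iff_of_nonneg fun e _ ↦
    intervalIntegral.integral_nonneg (left_le_right (Γ := Γ) e) fun x _ ↦
      mul_self_nonneg (u e x)).1 h0 e (Finset.mem_univ e)
  rw [intervalIntegral.integral_of_le (left_le_right e), ← integral_Icc_eq_integral_Ioc,
    integral_eq_zero_iff_of_nonneg (fun x ↦ mul_self_nonneg _) ((hu e).integrable_mul (hu e))]
    at h1
  filter_upwards [h1] with x hx
  exact mul_self_eq_zero.1 hx

/-- The pairing of the constant 1 with itself is the total length of the graph. -/
theorem edgeInner_one_one_pos [Nonempty E] :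
    0 < Γ.edgeInner (fun _ _ ↦ 1) (fun _ _ ↦ 1) := by
  simp only [edgeInner, mul_one, intervalIntegral.integral_const, smul_eq_mul]
  exact Finset.sum_pos (fun e _ ↦ sub_pos.2 (Γ.left_lt_right e)) Finset.univ_nonempty

theorem eqOn_zero_of_edgeInner_self (hu : ∀ e, ContinuousOn (u e) (Icc (Γ.left e) (Γ.right e)))
    (h0 : Γ.edgeInner u u = 0) (e : E) : EqOn (u e) 0 (Icc (Γ.left e) (Γ.right e)) := by
  have hae := ae_eq_zero_of_edgeInner_self (fun e ↦ memLp_two_of_continuousOn (hu e)) h0 e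
  exact Measure.eqOn_Icc_of_ae_eq volume (Γ.left_lt_right e).ne hae (hu e) continuousOn_const

end Inner

/-! ### Compactness of the form domain -/

section Compactness

variable [Fintype E]

theorem sq_sub_le_edgeInner (hf : Γ.InFormDomain f g) (e : E) {x y : ℝ}
    (hx : x ∈ Icc (Γ.left e) (Γ.right e)) (hy : y ∈ Icc (Γ.left e) (Γ.right e)) :
    (f e y - f e x) ^ 2 ≤ |y - x| * Γ.edgeInner g g := by
  refine ((hf.weakDeriv e).sq_sub_le hx hy).trans ?_
  refine mul_le_mul_of_nonneg_left ?_ (abs_nonneg _)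
  exact Finset.single_le_sum (f := fun e ↦ ∫ x in Γ.left e..Γ.right e, g e x * g e x)
    (fun e _ ↦ intervalIntegral.integral_nonneg (left_le_right e) fun _ _ ↦ mul_self_nonneg _)
    (Finset.mem_univ e)

/-- Integrate $f(x)^2\le 2f(t)^2+2(f(x)-f(t))^2$ over `t` in the edge and bound the last term by the
Hölder estimate. -/
theorem exists_forall_abs_le (Γ : MetricGraph V E) (N Q : ℝ) :
    ∃ M : ℝ, ∀ f g, Γ.InFormDomain f g → Γ.edgeInner f f ≤ N → Γ.edgeInner g g ≤ Q →
      ∀ e, ∀ x ∈ Icc (Γ.left e) (Γ.right e), |f e x| ≤ M := by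
  let l : E → ℝ := fun e ↦ Γ.right e - Γ.left e
  have hl : ∀ e, 0 < l e := fun e ↦ sub_pos.2 (Γ.left_lt_right e)
  -- Each summand bounds $f(x)^2+1\ge|f(x)|$ on its edge; since the summands are nonnegative, the
  -- sum serves all edges at once.
  refine ⟨∑ e, (2 * (|N| + l e * (l e * |Q|)) / l e + 1), fun f g hf hN hQ e x hx ↦ ?_⟩
  have hfe : (f e x) ^ 2 ≤ 2 * (|N| + l e * (l e * |Q|)) / l e := by
    have hpt : ∀ t ∈ Icc (Γ.left e) (Γ.right e),
        (f e x) ^ 2 ≤ 2 * (f e t * f e t) + 2 * (l e * |Q|) := by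
      intro t ht
      have h1 := sq_sub_le_edgeInner hf e ht hx
      have h2 : |x - t| ≤ l e := by
        rw [abs_le]; constructor <;> simp only [l] <;> linarith [hx.1, hx.2, ht.1, ht.2]
      have h3 : |x - t| * Γ.edgeInner g g ≤ l e * |Q| :=
        mul_le_mul h2 (hQ.trans (le_abs_self Q)) (edgeInner_self_nonneg g) (hl e).le
      nlinarith [sq_nonneg (f e x - 2 * f e t)]
    have hi := intervalIntegrable_mul_of_memLp_two (left_le_right e) (hf.squareIntegrable e)
      (hf.squareIntegrable e)
    have hint := intervalIntegral.integral_mono_on (left_le_right e) (by simp)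
      ((hi.const_mul 2).add (by simp)) hpt
    rw [intervalIntegral.integral_add (hi.const_mul 2) (by simp),
      intervalIntegral.integral_const_mul] at hint
    simp only [intervalIntegral.integral_const, smul_eq_mul] at hint
    have hle : ∫ t in Γ.left e..Γ.right e, f e t * f e t ≤ |N| := by
      refine (Finset.single_le_sum (f := fun e ↦ ∫ x in Γ.left e..Γ.right e, f e x * f e x)
        (fun e _ ↦ intervalIntegral.integral_nonneg (left_le_right e) fun _ _ ↦
          mul_self_nonneg _) (Finset.mem_univ e)).trans (hN.trans (le_abs_self N))
    rw [le_div_iff₀ (hl e)]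
    change l e * (f e x) ^ 2 ≤ _ + l e * _ at hint
    linarith
  have h1 : |f e x| ≤ 2 * (|N| + l e * (l e * |Q|)) / l e + 1 := by
    nlinarith [sq_abs (f e x), sq_nonneg (|f e x| - 1), abs_nonneg (f e x)]
  refine h1.trans (Finset.single_le_sum
    (f := fun e ↦ 2 * (|N| + l e * (l e * |Q|)) / l e + 1) (fun e _ ↦ ?_) (Finset.mem_univ e))
  have := hl e
  positivity

/-- Rellich compactness: a bounded sequence in the form domain has a uniformly convergent
subsequence. -/
theorem exists_subseq_tendsto_uniformly {F G : ℕ → E → ℝ → ℝ}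
    (hF : ∀ n, Γ.InFormDomain (F n) (G n)) {N Q : ℝ} (hN : ∀ n, Γ.edgeInner (F n) (F n) ≤ N)
    (hQ : ∀ n, Γ.edgeInner (G n) (G n) ≤ Q) :
    ∃ (φ : ℕ → ℕ) (f : E → ℝ → ℝ), StrictMono φ ∧ ∀ ε > 0, ∃ n₀, ∀ n ≥ n₀,
      ∀ e, ∀ x ∈ Icc (Γ.left e) (Γ.right e), |F (φ n) e x - f e x| < ε := by
  obtain ⟨M, hM⟩ := exists_forall_abs_le Γ N Q
  -- The disjoint union of the finitely many closed edges is compact, so Arzelà–Ascoli applies on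
  -- it; equicontinuity comes from the Hölder estimate with the common energy bound `Q`.
  let X := Σ e, Icc (Γ.left e) (Γ.right e)
  have hcont : ∀ n, Continuous fun p : X ↦ F n p.1 p.2 := fun n ↦
    continuous_sigma fun e ↦
      continuousOn_iff_continuous_domRestrict.1 (((hF n).weakDeriv e).continuousOn (left_le_right e))
  let Φ : ℕ → BoundedContinuousFunction X ℝ :=
    fun n ↦ BoundedContinuousFunction.mkOfCompact ⟨_, hcont n⟩
  have hcpt : IsCompact (closure (range Φ)) := by
    refine BoundedContinuousFunction.arzela_ascoli (Icc (-M) M) isCompact_Icc _ ?_ ?_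
    · rintro _ p ⟨n, rfl⟩
      exact abs_le.1 (hM _ _ (hF n) (hN n) (hQ n) p.1 p.2 p.2.2)
    · rintro ⟨e, x⟩
      rw [Metric.equicontinuousAt_iff_right]
      intro ε hε
      rw [Sigma.nhds_mk, eventually_map]
      have ht : Tendsto (fun y : Icc (Γ.left e) (Γ.right e) ↦ |(x : ℝ) - y| * Q) (𝓝 x) (𝓝 0) := by
        have : Continuous fun y : Icc (Γ.left e) (Γ.right e) ↦ |(x : ℝ) - y| * Q := by fun_prop
        simpa using this.tendsto x
      filter_upwards [ht.eventually_lt_const (show 0 < ε ^ 2 by positivity)] with y hy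
      rintro ⟨_, n, rfl⟩
      have h1 := sq_sub_le_edgeInner (hF n) e y.2 x.2
      have h2 : (F n e x - F n e y) ^ 2 < ε ^ 2 :=
        h1.trans_lt ((mul_le_mul_of_nonneg_left (hQ n) (abs_nonneg _)).trans_lt hy)
      exact abs_lt_of_sq_lt_sq h2 hε.le
  obtain ⟨Ψ, -, φ, hφ, hlim⟩ := hcpt.tendsto_subseq fun n ↦ subset_closure (mem_range_self n)
  refine ⟨φ, fun e x ↦ Ψ ⟨e, projIcc _ _ (left_le_right e) x⟩, hφ, fun ε hε ↦ ?_⟩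
  obtain ⟨n₀, hn₀⟩ := Metric.tendsto_atTop.1 hlim ε hε
  refine ⟨n₀, fun n hn e x hx ↦ ?_⟩
  simp only [projIcc_of_mem _ hx]
  exact (BoundedContinuousFunction.dist_coe_le_dist (⟨e, x, hx⟩ : X)).trans_lt (hn₀ n hn)

theorem edgeInner_self_le_of_abs_le {ε : ℝ} (hu : Γ.SquareIntegrable u)
    (h : ∀ e, ∀ x ∈ Icc (Γ.left e) (Γ.right e), |u e x| ≤ ε) :
    Γ.edgeInner u u ≤ Γ.edgeInner (fun _ _ ↦ 1) (fun _ _ ↦ 1) * ε ^ 2 := by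
  rw [edgeInner, edgeInner, Finset.sum_mul]
  refine Finset.sum_le_sum fun e _ ↦ ?_
  rw [← intervalIntegral.integral_mul_const]
  refine intervalIntegral.integral_mono_on (left_le_right e)
    (intervalIntegrable_mul_of_memLp_two (left_le_right e) (hu e) (hu e)) (by simp) fun x hx ↦ ?_
  rw [one_mul, one_mul, ← sq, ← sq_abs]
  exact pow_le_pow_left₀ (abs_nonneg _) (h e x hx) 2

end Compactness

end MetricGraph

namespace MetricGraph

variable {V E : Type*} {Γ : MetricGraph V E} {f g h k u v w : E → ℝ → ℝ}

/-! ### Existence of minimizers and the Euler–Lagrange equation -/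

section Minimizer

variable [Fintype E]

theorem edgeInner_smul_smul (c : ℝ) (u v : E → ℝ → ℝ) :
    Γ.edgeInner (c • u) (c • v) = c * c * Γ.edgeInner u v := by
  rw [edgeInner_smul_left, edgeInner_comm, edgeInner_smul_left, edgeInner_comm, mul_assoc]

theorem edgeInner_sq_le (hu : Γ.SquareIntegrable u) (hv : Γ.SquareIntegrable v) :
    Γ.edgeInner u v ^ 2 ≤ Γ.edgeInner u u * Γ.edgeInner v v := by
  -- The squared norm of `u + c • v` is a nonnegative quadratic in `c`, so its discriminant is not
  -- positive.
  have h1 : ∀ c : ℝ, 0 ≤ Γ.edgeInner v v * (c * c) + 2 * Γ.edgeInner u v * c +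
      Γ.edgeInner u u := by
    intro c
    have := edgeInner_self_nonneg (Γ := Γ) (u + c • v)
    rw [edgeInner_add_smul_self c hu hv] at this
    linarith
  have := discrim_le_zero h1
  rw [discrim] at this
  linarith

theorem tendsto_edgeInner_left {u : ℕ → E → ℝ → ℝ} (hu : ∀ n, Γ.SquareIntegrable (u n))
    (hv : Γ.SquareIntegrable v) (hw : Γ.SquareIntegrable w)
    (h : Tendsto (fun n ↦ Γ.edgeInner (u n - v) (u n - v)) atTop (𝓝 0)) :
    Tendsto (fun n ↦ Γ.edgeInner (u n) w) atTop (𝓝 (Γ.edgeInner v w)) := by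
  have h1 : Tendsto (fun n ↦ Γ.edgeInner (u n - v) w ^ 2) atTop (𝓝 0) := by
    refine squeeze_zero (fun n ↦ sq_nonneg _) (fun n ↦ edgeInner_sq_le ((hu n).sub hv) hw) ?_
    simpa using h.mul_const (Γ.edgeInner w w)
  have h2 : Tendsto (fun n ↦ Γ.edgeInner (u n - v) w) atTop (𝓝 0) := by
    have h3 := h1.sqrt
    simp only [Real.sqrt_sq_eq_abs, Real.sqrt_zero] at h3
    exact (tendsto_zero_iff_abs_tendsto_zero _).2 h3
  have h4 := h2.add_const (Γ.edgeInner v w)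
  rw [zero_add] at h4
  refine h4.congr fun n ↦ ?_
  rw [← edgeInner_add_left ((hu n).sub hv) hv hw, sub_add_cancel]

theorem tendsto_edgeInner_self {u : ℕ → E → ℝ → ℝ} (hu : ∀ n, Γ.SquareIntegrable (u n))
    (hv : Γ.SquareIntegrable v)
    (h : Tendsto (fun n ↦ Γ.edgeInner (u n - v) (u n - v)) atTop (𝓝 0)) :
    Tendsto (fun n ↦ Γ.edgeInner (u n) (u n)) atTop (𝓝 (Γ.edgeInner v v)) := by
  have h1 := (tendsto_edgeInner_left hu hv hv h).const_mul 2
  have h2 := (h.add h1).sub_const (Γ.edgeInner v v)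
  have h3 : 0 + 2 * Γ.edgeInner v v - Γ.edgeInner v v = Γ.edgeInner v v := by ring
  rw [h3] at h2
  refine h2.congr fun n ↦ ?_
  have := edgeInner_add_smul_self (-1) (hu n) hv
  rw [neg_one_smul, ← sub_eq_add_neg] at this
  rw [this]
  ring

theorem tendsto_edgeInner_sub_self_of_uniform {u : ℕ → E → ℝ → ℝ}
    (hu : ∀ n, Γ.SquareIntegrable (u n)) (hv : Γ.SquareIntegrable v)
    (h : ∀ ε > 0, ∃ n₀, ∀ n ≥ n₀, ∀ e, ∀ x ∈ Icc (Γ.left e) (Γ.right e), |u n e x - v e x| < ε) :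
    Tendsto (fun n ↦ Γ.edgeInner (u n - v) (u n - v)) atTop (𝓝 0) := by
  rw [Metric.tendsto_atTop]
  intro ε hε
  obtain ⟨c, hc, hcε⟩ := exists_pos_mul_lt hε (Γ.edgeInner (fun _ _ ↦ 1) (fun _ _ ↦ 1))
  obtain ⟨n₀, hn₀⟩ := h (√c) (Real.sqrt_pos.2 hc)
  refine ⟨n₀, fun n hn ↦ ?_⟩
  rw [dist_zero_right, Real.norm_of_nonneg (edgeInner_self_nonneg _)]
  refine (edgeInner_self_le_of_abs_le ((hu n).sub hv)
    fun e x hx ↦ (hn₀ n hn e x hx).le).trans_lt ?_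
  rwa [Real.sq_sqrt hc.le]

theorem SquareIntegrable.exists_tendsto_of_cauchy {u : ℕ → E → ℝ → ℝ}
    (hu : ∀ n, Γ.SquareIntegrable (u n))
    (hc : ∀ ε > 0, ∃ N, ∀ m ≥ N, ∀ n ≥ N, Γ.edgeInner (u m - u n) (u m - u n) < ε) :
    ∃ v, Γ.SquareIntegrable v ∧
      (∀ e, Tendsto (fun n ↦ ∫ x in Γ.left e..Γ.right e, (u n e x - v e x) * (u n e x - v e x))
        atTop (𝓝 0)) ∧
      Tendsto (fun n ↦ Γ.edgeInner (u n - v) (u n - v)) atTop (𝓝 0) := by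
  have hv : ∀ e, ∃ v : ℝ → ℝ, MemLp v 2 (volume.restrict (Icc (Γ.left e) (Γ.right e))) ∧
      Tendsto (fun n ↦ ∫ x in Γ.left e..Γ.right e, (u n e x - v x) * (u n e x - v x))
        atTop (𝓝 0) := by
    refine fun e ↦ exists_memLp_two_tendsto_of_cauchy (left_le_right e) (fun n ↦ hu n e) ?_
    intro ε hε
    obtain ⟨N, hN⟩ := hc ε hε
    refine ⟨N, fun m hm n hn ↦ lt_of_le_of_lt ?_ (hN m hm n hn)⟩
    exact Finset.single_le_sum
      (f := fun e ↦ ∫ x in Γ.left e..Γ.right e, (u m - u n) e x * (u m - u n) e x)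
      (fun e _ ↦ intervalIntegral.integral_nonneg (left_le_right e) fun _ _ ↦ mul_self_nonneg _)
      (Finset.mem_univ e)
  choose v hv1 hv2 using hv
  refine ⟨v, hv1, hv2, ?_⟩
  have := tendsto_finsetSum Finset.univ fun e _ ↦ hv2 e
  simpa [edgeInner] using this

/-- The Rayleigh quotient attains its minimum among the functions of mean value zero. -/
theorem exists_rayleigh_minimizer
    (hne : ∃ f g, Γ.InFormDomain f g ∧ Γ.edgeInner f (fun _ _ ↦ 1) = 0 ∧ Γ.edgeInner f f = 1) :
    ∃ f g, Γ.InFormDomain f g ∧ Γ.edgeInner f (fun _ _ ↦ 1) = 0 ∧ Γ.edgeInner f f = 1 ∧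
      ∀ h k, Γ.InFormDomain h k → Γ.edgeInner h (fun _ _ ↦ 1) = 0 →
        Γ.edgeInner g g * Γ.edgeInner h h ≤ Γ.edgeInner k k := by
  let S : Set ℝ := {q | ∃ f g, Γ.InFormDomain f g ∧ Γ.edgeInner f (fun _ _ ↦ 1) = 0 ∧
    Γ.edgeInner f f = 1 ∧ q = Γ.edgeInner g g}
  have hSne : S.Nonempty := by
    obtain ⟨f, g, h1, h2, h3⟩ := hne
    exact ⟨_, f, g, h1, h2, h3, rfl⟩
  have hSbdd : BddBelow S := by
    refine ⟨0, ?_⟩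
    rintro _ ⟨f, g, -, -, -, rfl⟩
    exact edgeInner_self_nonneg g
  set c := sInf S with hc
  have hc0 : 0 ≤ c := by
    refine le_csInf hSne ?_
    rintro _ ⟨f, g, -, -, -, rfl⟩
    exact edgeInner_self_nonneg g
  -- By homogeneity the infimum over unit functions bounds the quotient of every function of mean
  -- value zero.
  have hmin : ∀ h k, Γ.InFormDomain h k → Γ.edgeInner h (fun _ _ ↦ 1) = 0 →
      c * Γ.edgeInner h h ≤ Γ.edgeInner k k := by
    intro h k hhk h0
    rcases (edgeInner_self_nonneg (Γ := Γ) h).eq_or_lt with hz | hpos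
    · rw [← hz, mul_zero]
      exact edgeInner_self_nonneg k
    · set s := (√(Γ.edgeInner h h))⁻¹ with hs
      have hs2 : s * s * Γ.edgeInner h h = 1 := by
        rw [hs, ← mul_inv, Real.mul_self_sqrt hpos.le, inv_mul_cancel₀ hpos.ne']
      have hmem : s * s * Γ.edgeInner k k ∈ S := by
        refine ⟨s • h, s • k, hhk.const_smul s, ?_, ?_, ?_⟩
        · rw [edgeInner_smul_left, h0, mul_zero]
        · rw [edgeInner_smul_smul, hs2]
        · rw [edgeInner_smul_smul]
      have hle := mul_le_mul_of_nonneg_right (csInf_le hSbdd hmem) hpos.le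
      calc c * Γ.edgeInner h h ≤ s * s * Γ.edgeInner k k * Γ.edgeInner h h := hle
        _ = (s * s * Γ.edgeInner h h) * Γ.edgeInner k k := by ring
        _ = Γ.edgeInner k k := by rw [hs2, one_mul]
  obtain ⟨q, hqanti, hqlim, hqS⟩ := exists_seq_tendsto_sInf hSne hSbdd
  choose F₀ G₀ hF₀ hmean₀ hnorm₀ hq₀ using hqS
  obtain ⟨φ, f, hφ, hunif⟩ := exists_subseq_tendsto_uniformly hF₀ (N := 1) (Q := q 0)
    (fun n ↦ (hnorm₀ n).le) (fun n ↦ (hq₀ n).symm.le.trans (hqanti (Nat.zero_le n)))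
  set F := fun n ↦ F₀ (φ n)
  set G := fun n ↦ G₀ (φ n)
  have hF : ∀ n, Γ.InFormDomain (F n) (G n) := fun n ↦ hF₀ (φ n)
  have hmean : ∀ n, Γ.edgeInner (F n) (fun _ _ ↦ 1) = 0 := fun n ↦ hmean₀ (φ n)
  have hnorm : ∀ n, Γ.edgeInner (F n) (F n) = 1 := fun n ↦ hnorm₀ (φ n)
  have hlim : Tendsto (fun n ↦ Γ.edgeInner (G n) (G n)) atTop (𝓝 c) :=
    (hqlim.comp hφ.tendsto_atTop).congr fun n ↦ hq₀ (φ n)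
  -- The sum `F m + F n` has mean value zero and squared norm $4-\|F_m-F_n\|^2$, so its energy is at
  -- least `c` times that. The parallelogram identity leaves for `G m - G n` at most
  -- $\varepsilon/2+c\|F_m-F_n\|^2$: the `ε / 8` enters four times, and the choice of `d` makes the
  -- second term less than $\varepsilon/2$.
  have hcauchy : ∀ ε > 0, ∃ N, ∀ m ≥ N, ∀ n ≥ N, Γ.edgeInner (G m - G n) (G m - G n) < ε := by
    intro ε hε
    obtain ⟨d, hd, hdε⟩ := exists_pos_mul_lt (half_pos hε)
      (c * Γ.edgeInner (fun _ _ ↦ 1) (fun _ _ ↦ 1))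
    obtain ⟨N₁, hN₁⟩ := hunif (√d / 2) (by positivity)
    obtain ⟨N₂, hN₂⟩ := eventually_atTop.1
      (hlim.eventually_lt_const (show c < c + ε / 8 by linarith))
    refine ⟨max N₁ N₂, fun m hm n hn ↦ ?_⟩
    have hdiff : Γ.edgeInner (F m - F n) (F m - F n) ≤
        Γ.edgeInner (fun _ _ ↦ 1) (fun _ _ ↦ 1) * d := by
      rw [← Real.sq_sqrt hd.le]
      refine edgeInner_self_le_of_abs_le ((hF m).sub (hF n)).squareIntegrable fun e x hx ↦ ?_
      have h1 := hN₁ m ((le_max_left _ _).trans hm) e x hx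
      have h2 := hN₁ n ((le_max_left _ _).trans hn) e x hx
      rw [abs_lt] at h1 h2
      simp only [Pi.sub_apply, abs_le]
      constructor <;> linarith
    have hsum := hmin _ _ ((hF m).add (hF n)) (by
      rw [edgeInner_add_left (hF m).squareIntegrable (hF n).squareIntegrable
        (squareIntegrable_const 1), hmean, hmean, add_zero])
    have hp1 := edgeInner_parallelogram (hF m).squareIntegrable (hF n).squareIntegrable
    have hp2 := edgeInner_parallelogram (hF m).squareIntegrable_deriv (hF n).squareIntegrable_deriv
    rw [hnorm, hnorm] at hp1
    have h1 := hN₂ m ((le_max_right _ _).trans hm)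
    have h2 := hN₂ n ((le_max_right _ _).trans hn)
    have h3 := mul_le_mul_of_nonneg_left hdiff hc0
    have h4 : Γ.edgeInner (F m + F n) (F m + F n) =
        4 - Γ.edgeInner (F m - F n) (F m - F n) := by linarith
    rw [h4, mul_sub] at hsum
    linarith
  obtain ⟨g, hg, hge, hgG⟩ := SquareIntegrable.exists_tendsto_of_cauchy
    (fun n ↦ (hF n).squareIntegrable_deriv) hcauchy
  have hpt : ∀ e, ∀ x ∈ Icc (Γ.left e) (Γ.right e),
      Tendsto (fun n ↦ F n e x) atTop (𝓝 (f e x)) := by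
    intro e x hx
    rw [Metric.tendsto_atTop]
    intro ε hε
    obtain ⟨n₀, hn₀⟩ := hunif ε hε
    exact ⟨n₀, fun n hn ↦ hn₀ n hn e x hx⟩
  have hfg : Γ.InFormDomain f g := by
    refine ⟨fun e ↦ HasWeakDeriv.of_tendsto (left_le_right e) (fun n ↦ (hF n).weakDeriv e) (hg e)
      (hge e) (hpt e), fun p r hpr ↦ ?_⟩
    refine tendsto_nhds_unique (hpt p.1 _ (coord_mem p)) ?_
    exact (hpt r.1 _ (coord_mem r)).congr fun n ↦ ((hF n).continuous p r hpr).symm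
  have hD := tendsto_edgeInner_sub_self_of_uniform (fun n ↦ (hF n).squareIntegrable)
    hfg.squareIntegrable hunif
  have hlim' := tendsto_edgeInner_self (fun n ↦ (hF n).squareIntegrable_deriv) hg hgG
  rw [tendsto_nhds_unique hlim hlim'] at hmin
  refine ⟨f, g, hfg, ?_, ?_, hmin⟩
  · refine tendsto_nhds_unique (tendsto_edgeInner_left (fun n ↦ (hF n).squareIntegrable)
      hfg.squareIntegrable (squareIntegrable_const 1) hD) ?_
    simp only [hmean, tendsto_const_nhds]
  · refine tendsto_nhds_unique (tendsto_edgeInner_self (fun n ↦ (hF n).squareIntegrable)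
      hfg.squareIntegrable hD) ?_
    simp only [hnorm, tendsto_const_nhds]

/-- The Euler–Lagrange equation for minimizers of the Rayleigh quotient. -/
theorem weak_eigenfunction_of_minimizer [Nonempty E] {c : ℝ} (hfg : Γ.InFormDomain f g)
    (hmean : Γ.edgeInner f (fun _ _ ↦ 1) = 0) (heq : Γ.edgeInner g g = c * Γ.edgeInner f f)
    (hmin : ∀ h k, Γ.InFormDomain h k → Γ.edgeInner h (fun _ _ ↦ 1) = 0 →
      c * Γ.edgeInner h h ≤ Γ.edgeInner k k)
    (hhk : Γ.InFormDomain h k) : Γ.edgeInner g k = c * Γ.edgeInner f h := by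
  -- The mean value of `h`. Subtracting it changes neither the derivative nor the pairing with `f`,
  -- and makes `h` an admissible variation.
  set m := Γ.edgeInner h (fun _ _ ↦ 1) / Γ.edgeInner (fun _ _ ↦ 1) (fun _ _ ↦ 1) with hm
  have hL := edgeInner_one_one_pos (Γ := Γ)
  have h1 : Γ.SquareIntegrable fun _ _ ↦ 1 := squareIntegrable_const 1
  have hhk' : Γ.InFormDomain (h + (-m) • fun (_ : E) (_ : ℝ) ↦ (1 : ℝ)) k := by
    have := hhk.add ((InFormDomain.const (Γ := Γ) 1).const_smul (-m))
    have hz : k + (-m) • (fun (_ : E) (_ : ℝ) ↦ (0 : ℝ)) = k := by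
      ext e x
      simp
    rwa [hz] at this
  have hmean' : Γ.edgeInner (h + (-m) • fun (_ : E) (_ : ℝ) ↦ (1 : ℝ)) (fun _ _ ↦ 1) = 0 := by
    rw [edgeInner_add_smul_left _ hhk.squareIntegrable h1 h1, hm]
    field_simp
    ring
  set h' : E → ℝ → ℝ := h + (-m) • (fun (_ : E) (_ : ℝ) ↦ (1 : ℝ)) with hh'
  have hf' : Γ.edgeInner f h' = Γ.edgeInner f h := by
    rw [hh', edgeInner_comm, edgeInner_add_smul_left _ hhk.squareIntegrable h1
      hfg.squareIntegrable, edgeInner_comm _ f, edgeInner_comm _ f, hmean]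
    ring
  -- Minimality at `f + t • h'`. The constant term vanishes because `f` attains equality, so
  -- nonnegativity for all `t` forces the linear coefficient to vanish.
  have hquad : ∀ t : ℝ, 0 ≤ (Γ.edgeInner k k - c * Γ.edgeInner h' h') * (t * t) +
      2 * (Γ.edgeInner g k - c * Γ.edgeInner f h') * t + 0 := by
    intro t
    have := hmin _ _ (hfg.add (hhk'.const_smul t)) (by
      rw [edgeInner_add_smul_left t hfg.squareIntegrable hhk'.squareIntegrable h1, hmean, hmean']
      ring)
    rw [edgeInner_add_smul_self t hfg.squareIntegrable hhk'.squareIntegrable,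
      edgeInner_add_smul_self t hfg.squareIntegrable_deriv hhk.squareIntegrable_deriv, heq] at this
    nlinarith
  have hd := discrim_le_zero hquad
  rw [discrim] at hd
  have : (Γ.edgeInner g k - c * Γ.edgeInner f h') ^ 2 ≤ 0 := by linarith
  have := pow_eq_zero_iff two_ne_zero |>.1 (le_antisymm this (sq_nonneg _))
  rw [← hf']
  linarith

theorem exists_meanZero_unit [DecidableEq E] [Nonempty E] :
    ∃ f g, Γ.InFormDomain f g ∧ Γ.edgeInner f (fun _ _ ↦ 1) = 0 ∧ Γ.edgeInner f f = 1 := by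
  suffices H : ∃ f g, Γ.InFormDomain f g ∧ Γ.edgeInner f (fun _ _ ↦ 1) = 0 ∧
      0 < Γ.edgeInner f f by
    obtain ⟨f, g, hfg, h0, hpos⟩ := H
    refine ⟨(√(Γ.edgeInner f f))⁻¹ • f, _, hfg.const_smul _, ?_, ?_⟩
    · rw [edgeInner_smul_left, h0, mul_zero]
    · rw [edgeInner_smul_smul, ← mul_inv, Real.mul_self_sqrt hpos.le, inv_mul_cancel₀ hpos.ne']
  obtain ⟨e₀⟩ := ‹Nonempty E›
  set a := Γ.left e₀ with ha
  set b := Γ.right e₀ with hb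
  have hab : a < b := Γ.left_lt_right e₀
  -- The derivative of $(x-a)^2(x-b)^2$: it has integral zero and vanishes at both ends, so its
  -- extension by zero to the other edges is in the form domain.
  let p : ℝ → ℝ := fun x ↦ 2 * (x - a) * (x - b) ^ 2 + 2 * (x - a) ^ 2 * (x - b)
  let p' : ℝ → ℝ := fun x ↦ 2 * (x - b) ^ 2 + 8 * (x - a) * (x - b) + 2 * (x - a) ^ 2
  have hp : ∀ x, HasDerivAt (fun x ↦ (x - a) ^ 2 * (x - b) ^ 2) (p x) x := by
    intro x
    have h1 := ((hasDerivAt_id x).sub_const a).pow 2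
    have h2 := ((hasDerivAt_id x).sub_const b).pow 2
    convert! h1.mul h2 using 1
    simp [p]
    ring
  have hp' : ∀ x, HasDerivAt p (p' x) x := by
    intro x
    have h1 := (hasDerivAt_id x).sub_const a
    have h2 := (hasDerivAt_id x).sub_const b
    convert! ((h1.const_mul 2).mul (h2.pow 2)).add (((h1.pow 2).const_mul 2).mul h2) using 1
    simp [p']
    ring
  have hpc : Continuous p := by fun_prop
  have hpc' : Continuous p' := by fun_prop
  have hwd : HasWeakDeriv a b p p' :=
    HasWeakDeriv.of_hasDerivWithinAt (fun x _ ↦ (hp' x).hasDerivWithinAt) hpc'.continuousOn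
  have hdom : Γ.InFormDomain (Pi.single e₀ p) (Pi.single e₀ p') := by
    have hend : ∀ q : E × Bool, (Pi.single e₀ p : E → ℝ → ℝ) q.1 (Γ.coord q) = 0 := by
      rintro ⟨e, i⟩
      by_cases he : e = e₀
      · subst he
        cases i <;> simp [coord, p, ← ha, ← hb]
      · simp [Pi.single_eq_of_ne he]
    refine ⟨fun e ↦ ?_, fun q r _ ↦ (hend q).trans (hend r).symm⟩
    by_cases he : e = e₀
    · subst he
      simpa using hwd
    · simp only [Pi.single_eq_of_ne he]
      exact HasWeakDeriv.const 0
  refine ⟨_, _, hdom, ?_, lt_of_le_of_ne (edgeInner_self_nonneg _) fun h0 ↦ ?_⟩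
  · rw [edgeInner, Finset.sum_eq_single e₀]
    · simp only [Pi.single_eq_same, mul_one]
      rw [intervalIntegral.integral_eq_sub_of_hasDerivAt (fun x _ ↦ hp x)
        (hpc.intervalIntegrable _ _)]
      simp [← ha, ← hb]
    · intro e _ he
      simp [Pi.single_eq_of_ne he]
    · simp
  · have hz := eqOn_zero_of_edgeInner_self
      (fun e ↦ (hdom.weakDeriv e).continuousOn (left_le_right e)) h0.symm e₀
    -- Besides the end points, `p` vanishes at the midpoint, hence the quarter point.
    have hmem : a + (b - a) / 4 ∈ Icc a b := ⟨by linarith, by linarith⟩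
    have := hz hmem
    simp only [Pi.single_eq_same, Pi.zero_apply, p] at this
    have h3 : 2 * (a + (b - a) / 4 - a) * (a + (b - a) / 4 - b) ^ 2 +
        2 * (a + (b - a) / 4 - a) ^ 2 * (a + (b - a) / 4 - b) = 3 / 16 * (b - a) ^ 3 := by ring
    rw [h3] at this
    have h4 : 0 < b - a := sub_pos.2 hab
    have : 0 < (b - a) ^ 3 := by positivity
    linarith

end Minimizer

end MetricGraph

/-! ### Green's formula -/

theorem AbsolutelyContinuousOnInterval.hasWeakDeriv {a b : ℝ} {f g : ℝ → ℝ}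
    (hf : AbsolutelyContinuousOnInterval f a b) (hg : MemLp g 2 (volume.restrict (Icc a b)))
    (h : ∀ᵐ x ∂volume.restrict (Icc a b), derivWithin f (Icc a b) x = g x) :
    HasWeakDeriv a b f g := by
  refine ⟨hg, fun x hx ↦ ?_⟩
  have hab : a ≤ b := hx.1.trans hx.2
  have hfx : AbsolutelyContinuousOnInterval f a x := hf.mono (by
    rw [uIcc_of_le hx.1, uIcc_of_le hab]
    exact Icc_subset_Icc_right hx.2)
  have hI : ∫ t in a..x, g t = ∫ t in a..x, deriv f t := by
    refine intervalIntegral.integral_congr_ae ?_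
    -- One-sided and two-sided derivatives can be compared only at interior points; the end point
    -- `b` is a null set.
    have hne : ∀ᵐ t : ℝ, t ≠ b := by simp [ae_iff, measure_singleton]
    filter_upwards [(ae_restrict_iff' measurableSet_Icc).1 h, hne] with t ht htb htm
    rw [uIoc_of_le hx.1] at htm
    have htb' := lt_of_le_of_ne (htm.2.trans hx.2) htb
    rw [← ht ⟨htm.1.le, htb'.le⟩, derivWithin_of_mem_nhds (Icc_mem_nhds htm.1 htb')]
  rw [hI, hfx.integral_deriv_eq_sub]
  ring

namespace MetricGraph

variable {V E : Type*} {Γ : MetricGraph V E} {f g h k : E → ℝ → ℝ}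

/-- The values at the end points, with the sign that makes `inward g` the normal derivative of a
function with derivative `g`. -/
def inward (Γ : MetricGraph V E) (g : E → ℝ → ℝ) : E × Bool → ℝ
  | (e, false) => g e (Γ.left e)
  | (e, true) => -g e (Γ.right e)

/-- The function on `Γ` given by the restrictions of functions of a real variable to the edges. -/
def ofEdges (Γ : MetricGraph V E) (f : E → ℝ → ℝ) : Γ.Fun := fun e x ↦ f e x

theorem onEdge_apply (u : Γ.Fun) (e : E) (x : Icc (Γ.left e) (Γ.right e)) :
    Γ.onEdge u e x = u e x :=
  IccExtend_val _ _ _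

theorem onEdge_ofEdges (e : E) : EqOn (Γ.onEdge (Γ.ofEdges f) e) (f e)
    (Icc (Γ.left e) (Γ.right e)) :=
  fun _ hx ↦ IccExtend_of_mem _ _ hx

theorem normalDeriv_eq_inward (u : Γ.Fun) (p : E × Bool) :
    Γ.normalDeriv u p = Γ.inward (Γ.deriv₁ u) p := by
  rcases p with ⟨e, _ | _⟩ <;> rfl

section FormulaOfGreen

variable [Fintype E]

/-- Integration by parts on each edge, with no vertex condition on `g`. It serves both to use the
Kirchhoff condition and to derive it. -/
theorem edgeInner_add_edgeInner {g' : E → ℝ → ℝ}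
    (hg : ∀ e, HasWeakDeriv (Γ.left e) (Γ.right e) (g e) (g' e)) (hhk : Γ.InFormDomain h k) :
    Γ.edgeInner g' h + Γ.edgeInner g k =
      -∑ p : E × Bool, Γ.inward g p * h p.1 (Γ.coord p) := by
  rw [edgeInner, edgeInner, ← Finset.sum_add_distrib, Fintype.sum_prod_type,
    ← Finset.sum_neg_distrib]
  refine Finset.sum_congr rfl fun e _ ↦ ?_
  rw [(hg e).integral_mul_add_mul (left_le_right e) (hhk.weakDeriv e), Fintype.sum_bool]
  simp only [inward, coord]
  ring

/-- Grouped by vertex, the boundary terms of Green's formula vanish: `h` has a single value at each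
vertex, which factors out of a Kirchhoff sum. -/
theorem edgeInner_deriv_of_kirchhoff [DecidableEq V] {g' : E → ℝ → ℝ}
    (hg : ∀ e, HasWeakDeriv (Γ.left e) (Γ.right e) (g e) (g' e))
    (hK : ∀ v, ∑ p : E × Bool with Γ.vert p = v, Γ.inward g p = 0) (hhk : Γ.InFormDomain h k) :
    Γ.edgeInner g k = -Γ.edgeInner g' h := by
  have h0 : ∑ p : E × Bool, Γ.inward g p * h p.1 (Γ.coord p) = 0 := by
    rw [← Finset.sum_fiberwise_of_maps_to (t := Finset.univ.image Γ.vert)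
      fun p hp ↦ Finset.mem_image_of_mem _ hp]
    refine Finset.sum_eq_zero fun v _ ↦ ?_
    obtain ⟨q, rfl⟩ := Γ.vert_surjective v
    rw [Finset.sum_congr rfl (g := fun p ↦ Γ.inward g p * h q.1 (Γ.coord q)), ← Finset.sum_mul,
      hK, zero_mul]
    intro p hp
    rw [hhk.continuous p q (Finset.mem_filter.1 hp).2]
  have := edgeInner_add_edgeInner hg hhk
  rw [h0] at this
  linarith

end FormulaOfGreen

/-! ### Weak and strong eigenfunctions -/

section Eigenfunction

variable [DecidableEq V] [Fintype E] {c : ℝ} {ψ : Γ.Fun}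

theorem IsEigenfunction.hasWeakDeriv (hψ : Γ.IsEigenfunction c ψ) (e : E) :
    HasWeakDeriv (Γ.left e) (Γ.right e) (Γ.onEdge ψ e) (Γ.deriv₁ ψ e) := by
  have hW := hψ.inDomain.sobolev e
  refine HasWeakDeriv.of_hasDerivWithinAt
    (fun x hx ↦ (hW.differentiableOn x hx).hasDerivWithinAt) ?_
  have := hW.absolutelyContinuous.continuousOn
  rwa [uIcc_of_le (left_le_right e)] at this

theorem IsEigenfunction.hasWeakDeriv_deriv (hψ : Γ.IsEigenfunction c ψ) (e : E) :
    HasWeakDeriv (Γ.left e) (Γ.right e) (Γ.deriv₁ ψ e) (((-c) • Γ.onEdge ψ) e) := by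
  refine (hψ.inDomain.sobolev e).absolutelyContinuous.hasWeakDeriv
    (((hψ.hasWeakDeriv e).memLp (left_le_right e)).const_smul (-c)) ?_
  filter_upwards [hψ.equation e] with x hx
  have h' : Γ.deriv₂ ψ e x = -c * Γ.onEdge ψ e x := by linarith
  exact h'

theorem IsEigenfunction.inFormDomain (hψ : Γ.IsEigenfunction c ψ) :
    Γ.InFormDomain (Γ.onEdge ψ) (Γ.deriv₁ ψ) :=
  ⟨hψ.hasWeakDeriv, hψ.inDomain.continuous⟩

/-- The weak form of the eigenvalue equation. -/
theorem IsEigenfunction.edgeInner_deriv (hψ : Γ.IsEigenfunction c ψ)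
    (hhk : Γ.InFormDomain h k) :
    Γ.edgeInner (Γ.deriv₁ ψ) k = c * Γ.edgeInner (Γ.onEdge ψ) h := by
  rw [edgeInner_deriv_of_kirchhoff hψ.hasWeakDeriv_deriv _ hhk, edgeInner_smul_left]
  · ring
  · intro v
    simpa only [normalDeriv_eq_inward] using hψ.inDomain.kirchhoff v

theorem IsEigenfunction.edgeInner_self_pos (hψ : Γ.IsEigenfunction c ψ) :
    0 < Γ.edgeInner (Γ.onEdge ψ) (Γ.onEdge ψ) := by
  refine lt_of_le_of_ne (edgeInner_self_nonneg _) fun h0 ↦ hψ.ne_zero ?_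
  ext e x
  rw [← onEdge_apply ψ e x]
  exact eqOn_zero_of_edgeInner_self
    (fun e ↦ (hψ.hasWeakDeriv e).continuousOn (left_le_right e)) h0.symm e x.2

/-- Test the weak equation with the constant function 1. -/
theorem IsEigenfunction.edgeInner_one (hψ : Γ.IsEigenfunction c ψ) (hc : c ≠ 0) :
    Γ.edgeInner (Γ.onEdge ψ) (fun _ _ ↦ 1) = 0 := by
  have := hψ.edgeInner_deriv (InFormDomain.const 1)
  have h0 : Γ.edgeInner (Γ.deriv₁ ψ) (fun _ _ ↦ 0) = 0 := by simp [edgeInner]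
  rw [h0] at this
  exact (mul_eq_zero.1 this.symm).resolve_left hc

/-- Since `f` and `g` are continuous on the edges, their weak derivatives `g` and `-c f` are
classical one-sided ones; as `-c f` is bounded, `g` is Lipschitz and so absolutely continuous. -/
theorem isEigenfunction_ofEdges {g : E → ℝ → ℝ} (hf : Γ.ofEdges f ≠ 0)
    (hfg : Γ.InFormDomain f g)
    (hg : ∀ e, HasWeakDeriv (Γ.left e) (Γ.right e) (g e) (((-c) • f) e))
    (hK : ∀ v, ∑ p : E × Bool with Γ.vert p = v, Γ.inward g p = 0) :
    Γ.IsEigenfunction c (Γ.ofEdges f) := by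
  have hgc : ∀ e, ContinuousOn (g e) (Icc (Γ.left e) (Γ.right e)) :=
    fun e ↦ (hg e).continuousOn (left_le_right e)
  have hfc : ∀ e, ContinuousOn (f e) (Icc (Γ.left e) (Γ.right e)) :=
    fun e ↦ (hfg.weakDeriv e).continuousOn (left_le_right e)
  have hud : ∀ e, UniqueDiffOn ℝ (Icc (Γ.left e) (Γ.right e)) :=
    fun e ↦ uniqueDiffOn_Icc (Γ.left_lt_right e)
  have hd1 : ∀ e, ∀ x ∈ Icc (Γ.left e) (Γ.right e), HasDerivWithinAt
      (Γ.onEdge (Γ.ofEdges f) e) (g e x) (Icc (Γ.left e) (Γ.right e)) x := fun e x hx ↦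
    ((hfg.weakDeriv e).hasDerivWithinAt (hgc e) hx).congr (onEdge_ofEdges e) (onEdge_ofEdges e hx)
  have he1 : ∀ e, EqOn (Γ.deriv₁ (Γ.ofEdges f) e) (g e) (Icc (Γ.left e) (Γ.right e)) :=
    fun e x hx ↦ (hd1 e x hx).derivWithin (hud e x hx)
  have hd2 : ∀ e, ∀ x ∈ Icc (Γ.left e) (Γ.right e), HasDerivWithinAt
      (Γ.deriv₁ (Γ.ofEdges f) e) (-c * f e x) (Icc (Γ.left e) (Γ.right e)) x := fun e x hx ↦
    ((hg e).hasDerivWithinAt ((hfc e).const_smul (-c)) hx).congr (he1 e) (he1 e hx)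
  have he2 : ∀ e, EqOn (Γ.deriv₂ (Γ.ofEdges f) e) (fun x ↦ -c * f e x)
      (Icc (Γ.left e) (Γ.right e)) :=
    fun e x hx ↦ (hd2 e x hx).derivWithin (hud e x hx)
  refine ⟨hf, ⟨fun e ↦ ⟨fun x hx ↦ (hd1 e x hx).differentiableWithinAt, ?_, ?_⟩, ?_, ?_⟩, ?_⟩
  · obtain ⟨C, hC⟩ := isCompact_Icc.exists_bound_of_continuousOn (hfc e)
    have hlip : LipschitzOnWith (|c| * |C|).toNNReal (Γ.deriv₁ (Γ.ofEdges f) e)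
        (Icc (Γ.left e) (Γ.right e)) := by
      refine (convex_Icc _ _).lipschitzOnWith_of_nnnorm_hasDerivWithin_le (hd2 e) fun x hx ↦ ?_
      rw [← NNReal.coe_le_coe, coe_nnnorm, Real.coe_toNNReal _ (by positivity), norm_mul, norm_neg]
      exact mul_le_mul_of_nonneg_left ((hC x hx).trans (le_abs_self C)) (abs_nonneg c)
    rw [← uIcc_of_le (left_le_right e)] at hlip
    exact hlip.absolutelyContinuousOnInterval
  · exact memLp_two_of_continuousOn (((hfc e).const_smul (-c)).congr (he2 e))
  · intro p q hpq
    rw [endValue, endValue, onEdge_ofEdges _ (coord_mem p), onEdge_ofEdges _ (coord_mem q)]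
    exact hfg.continuous p q hpq
  · intro v
    rw [← hK v]
    refine Finset.sum_congr rfl fun p _ ↦ ?_
    rcases p with ⟨e, _ | _⟩
    · exact he1 e (left_mem_Icc.2 (left_le_right e))
    · exact congrArg Neg.neg (he1 e (right_mem_Icc.2 (left_le_right e)))
  · intro e
    refine (ae_restrict_iff' measurableSet_Icc).2 (.of_forall fun x hx ↦ ?_)
    rw [he2 e hx, onEdge_ofEdges e hx]
    ring

/-- Elliptic regularity: weak solutions of the eigenvalue equation are eigenfunctions. -/
theorem isEigenfunction_of_weak (hf : Γ.ofEdges f ≠ 0) (hfg : Γ.InFormDomain f g)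
    (hw : ∀ h k, Γ.InFormDomain h k → Γ.edgeInner g k = c * Γ.edgeInner f h) :
    Γ.IsEigenfunction c (Γ.ofEdges f) := by
  classical
  have hreg : ∀ e, ∃ G : ℝ → ℝ, HasWeakDeriv (Γ.left e) (Γ.right e) G (((-c) • f) e) ∧
      ∀ᵐ x ∂volume.restrict (Icc (Γ.left e) (Γ.right e)), G x = g e x := by
    intro e
    set a := Γ.left e with ha
    set b := Γ.right e with hb
    have hab : a < b := Γ.left_lt_right e
    have hfe : MemLp (((-c) • f) e) 2 (volume.restrict (Icc a b)) :=
      (hfg.squareIntegrable e).const_smul (-c)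
    have hG₀ : HasWeakDeriv a b (fun x ↦ ∫ t in a..x, ((-c) • f) e t) (((-c) • f) e) :=
      ⟨hfe, fun x _ ↦ by simp⟩
    have hge : MemLp (g e) 2 (volume.restrict (Icc a b)) := hfg.squareIntegrable_deriv e
    -- The du Bois-Reymond argument: the constant `m / (b - a)` in the primitive `G` of `-c f` makes
    -- `g - G` integrate to zero. Its primitive `H` then vanishes at both ends and is a test
    -- function supported on this edge.
    set m := ∫ x in a..b, (g e x - ∫ t in a..x, ((-c) • f) e t) with hm
    set G : ℝ → ℝ := fun x ↦ (∫ t in a..x, ((-c) • f) e t) + m / (b - a) with hGdef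
    have hG : HasWeakDeriv a b G (((-c) • f) e) := by
      have := hG₀.add (HasWeakDeriv.const (a := a) (b := b) (m / (b - a)))
      have hz : (((-c) • f) e) + (fun _ : ℝ ↦ (0 : ℝ)) = ((-c) • f) e := by
        ext x
        simp
      rwa [hz] at this
    have hGL := hG.memLp hab.le
    have hmean : ∫ x in a..b, (g e x - G x) = 0 := by
      have h1 : ∀ x, g e x - G x = (g e x - ∫ t in a..x, ((-c) • f) e t) - m / (b - a) :=
        fun x ↦ by simp only [hGdef]; ring
      simp_rw [h1]
      have hi : IntervalIntegrable (fun x ↦ g e x - ∫ t in a..x, ((-c) • f) e t) volume a b :=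
        intervalIntegrable_of_memLp_two hab.le (hge.sub (hG₀.memLp hab.le))
      rw [intervalIntegral.integral_sub hi (by simp), ← hm,
        intervalIntegral.integral_const, smul_eq_mul, mul_div_cancel₀ _ (sub_pos.2 hab).ne',
        sub_self]
    set H : ℝ → ℝ := fun x ↦ ∫ t in a..x, (g e t - G t) with hH
    have hHw : HasWeakDeriv a b H (fun x ↦ g e x - G x) :=
      ⟨hge.sub hGL, fun x _ ↦ by simp [hH]⟩
    have hHa : H a = 0 := by simp [hH]
    have hHb : H b = 0 := hmean
    have hdom : Γ.InFormDomain (Pi.single e H) (Pi.single e (fun x ↦ g e x - G x)) := by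
      have hend : ∀ q : E × Bool, (Pi.single e H : E → ℝ → ℝ) q.1 (Γ.coord q) = 0 := by
        rintro ⟨e', i⟩
        by_cases he : e' = e
        · subst he
          cases i <;> simpa [coord]
        · simp [Pi.single_eq_of_ne he]
      refine ⟨fun e' ↦ ?_, fun q r _ ↦ (hend q).trans (hend r).symm⟩
      by_cases he : e' = e
      · subst he
        simpa using hHw
      · simp only [Pi.single_eq_of_ne he]
        exact HasWeakDeriv.const 0
    have h1 := hw _ _ hdom
    have h2 : Γ.edgeInner g (Pi.single e (fun x ↦ g e x - G x)) =
        ∫ x in a..b, g e x * (g e x - G x) := by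
      rw [edgeInner, Finset.sum_eq_single e]
      · simp [ha, hb]
      · intro e' _ he
        simp [Pi.single_eq_of_ne he]
      · simp
    have h3 : Γ.edgeInner f (Pi.single e H) = ∫ x in a..b, f e x * H x := by
      rw [edgeInner, Finset.sum_eq_single e]
      · simp [ha, hb]
      · intro e' _ he
        simp [Pi.single_eq_of_ne he]
      · simp
    have h4 := hG.integral_mul_add_mul hab.le hHw
    have h5 : ∫ x in a..b, ((-c) • f) e x * H x = -c * ∫ x in a..b, f e x * H x := by
      rw [← intervalIntegral.integral_const_mul]
      simp only [Pi.smul_apply, smul_eq_mul, mul_assoc]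
    rw [h2, h3] at h1
    rw [hHa, hHb, h5] at h4
    -- The weak equation tested with `H`, minus integration by parts of `G` against `H`.
    have h6 : ∫ x in a..b, (g e x - G x) * (g e x - G x) = 0 := by
      have : ∀ x, (g e x - G x) * (g e x - G x) =
        g e x * (g e x - G x) - G x * (g e x - G x) := fun x ↦ by ring
      simp_rw [this]
      rw [intervalIntegral.integral_sub (intervalIntegrable_mul_of_memLp_two hab.le hge hHw.1)
        (intervalIntegrable_mul_of_memLp_two hab.le hGL hHw.1)]
      linarith
    refine ⟨G, hG, ?_⟩
    rw [intervalIntegral.integral_of_le hab.le, ← integral_Icc_eq_integral_Ioc,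
      integral_eq_zero_iff_of_nonneg (fun x ↦ mul_self_nonneg _) (hHw.1.integrable_mul hHw.1)]
      at h6
    filter_upwards [h6] with x hx
    exact (sub_eq_zero.1 (mul_self_eq_zero.1 hx)).symm
  choose G hG hGg using hreg
  have hfG : Γ.InFormDomain f G :=
    ⟨fun e ↦ (hfg.weakDeriv e).congr (fun _ _ ↦ rfl) (hGg e), hfg.continuous⟩
  refine isEigenfunction_ofEdges hf hfG hG fun v ↦ ?_
  -- Testing with the edgewise affine function equal to 1 at `v` and 0 at the other vertices reduces
  -- the boundary sum in Green's formula to the Kirchhoff sum at `v`.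
  let χ : E × Bool → ℝ := fun p ↦ if Γ.vert p = v then 1 else 0
  let s : E → ℝ := fun e ↦ (χ (e, true) - χ (e, false)) / (Γ.right e - Γ.left e)
  let h : E → ℝ → ℝ := fun e x ↦ χ (e, false) + s e * (x - Γ.left e)
  have hval : ∀ p : E × Bool, h p.1 (Γ.coord p) = χ p := by
    rintro ⟨e, _ | _⟩
    · simp [h, coord]
    · have := (sub_pos.2 (Γ.left_lt_right e)).ne'
      simp only [h, coord, s]
      field_simp
      ring
  have hdom : Γ.InFormDomain h fun e _ ↦ s e := by
    refine ⟨fun e ↦ HasWeakDeriv.of_hasDerivWithinAt (fun x _ ↦ ?_) continuousOn_const,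
      fun p q hpq ↦ ?_⟩
    · have := (((hasDerivAt_id x).sub_const (Γ.left e)).const_mul (s e)).const_add (χ (e, false))
      rw [mul_one] at this
      exact this.hasDerivWithinAt
    · rw [hval, hval]
      simp only [χ, hpq]
  have h1 := hw _ _ hdom
  have h2 := edgeInner_add_edgeInner hG hdom
  rw [edgeInner_congr hGg (fun e ↦ .of_forall fun _ ↦ rfl), h1] at h2
  have h3 : Γ.edgeInner ((-c) • f) h = -c * Γ.edgeInner f h := edgeInner_smul_left _ _ _
  rw [h3] at h2
  have h4 : ∑ p : E × Bool, Γ.inward G p * h p.1 (Γ.coord p) = 0 := by linarith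
  simp only [hval, χ, mul_ite, mul_one, mul_zero] at h4
  rwa [Finset.sum_filter]

end Eigenfunction

/-! ### Connectedness and functions of zero energy -/

section Connected

theorem IsConnected.nonempty_edges (hΓ : Γ.IsConnected) : Nonempty E := by
  obtain ⟨⟨v⟩, -⟩ := hΓ
  obtain ⟨p, -⟩ := Γ.vert_surjective v
  exact ⟨p.1⟩

/-- Zero energy makes `f` constant on each edge by the Hölder estimate; continuity at the vertices
carries the constant along chains of edges. -/
theorem IsConnected.exists_eq_const [Fintype E] (hΓ : Γ.IsConnected) (hfg : Γ.InFormDomain f g)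
    (h0 : Γ.edgeInner g g = 0) :
    ∃ c, ∀ e, ∀ x ∈ Icc (Γ.left e) (Γ.right e), f e x = c := by
  have hedge : ∀ e, ∀ x ∈ Icc (Γ.left e) (Γ.right e), f e x = f e (Γ.left e) := by
    intro e x hx
    have hsq := sq_sub_le_edgeInner hfg e (left_mem_Icc.2 (left_le_right e)) hx
    rw [h0, mul_zero] at hsq
    exact sub_eq_zero.1 (pow_eq_zero_iff two_ne_zero |>.1 (le_antisymm hsq (sq_nonneg _)))
  have hchain : ∀ v w, Relation.EqvGen
      (fun p q ↦ ∃ e, Γ.vert (e, false) = p ∧ Γ.vert (e, true) = q) v w →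
      ∀ p q, Γ.vert p = v → Γ.vert q = w → f p.1 (Γ.coord p) = f q.1 (Γ.coord q) := by
    intro v w hvw
    induction hvw with
    | rel v w h =>
      obtain ⟨e, rfl, rfl⟩ := h
      intro p q hp hq
      rw [hfg.continuous _ _ hp, hfg.continuous _ _ hq]
      exact (hedge e _ (right_mem_Icc.2 (left_le_right e))).symm
    | refl v => exact fun p q hp hq ↦ hfg.continuous _ _ (hp.trans hq.symm)
    | symm v w _ ih => exact fun p q hp hq ↦ (ih q p hq hp).symm
    | trans v w z _ _ ih1 ih2 =>
      intro p q hp hq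
      obtain ⟨r, hr⟩ := Γ.vert_surjective w
      exact (ih1 p r hp hr).trans (ih2 r q hr hq)
  obtain ⟨e₀⟩ := hΓ.nonempty_edges
  refine ⟨f e₀ (Γ.left e₀), fun e x hx ↦ ?_⟩
  rw [hedge e x hx]
  exact hchain _ _ (hΓ.2 _ _) (e, false) (e₀, false) rfl rfl

end Connected

/-! ### Variational description of the first excited eigenvalue -/

section Spectrum

variable [DecidableEq V] [Fintype E]

theorem isEigenfunction_const [Nonempty E] :
    Γ.IsEigenfunction 0 (Γ.ofEdges fun _ _ ↦ 1) := by
  refine isEigenfunction_of_weak (g := fun _ _ ↦ 0) ?_ (InFormDomain.const 1) ?_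
  · intro h0
    obtain ⟨e⟩ := ‹Nonempty E›
    have := congrFun (congrFun h0 e) ⟨_, left_mem_Icc.2 (left_le_right e)⟩
    exact one_ne_zero this
  · intro h k _
    simp [edgeInner]

/-- The first excited eigenvalue of a connected graph is attained, it is positive, and it is the
minimum of the Rayleigh quotient on the functions of mean value zero. -/
theorem IsConnected.eigenvalue_one (hΓ : Γ.IsConnected) :
    IsLeast (Γ.eigenvalueBounds 1) (Γ.eigenvalue 1) ∧ 0 < Γ.eigenvalue 1 ∧
      (∃ ψ, Γ.IsEigenfunction (Γ.eigenvalue 1) ψ) ∧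
      ∀ h k, Γ.InFormDomain h k → Γ.edgeInner h (fun _ _ ↦ 1) = 0 →
        Γ.eigenvalue 1 * Γ.edgeInner h h ≤ Γ.edgeInner k k := by
  classical
  have := hΓ.nonempty_edges
  obtain ⟨f, g, hfg, hmean, hnorm, hmin⟩ := exists_rayleigh_minimizer
    (exists_meanZero_unit (Γ := Γ))
  set c := Γ.edgeInner g g with hc
  have hL := edgeInner_one_one_pos (Γ := Γ)
  have hconst : ∀ {d : ℝ}, (∀ e, ∀ x ∈ Icc (Γ.left e) (Γ.right e), f e x = d) → d = 0 := by
    intro d hd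
    have h1 : Γ.edgeInner f (fun _ _ ↦ 1) =
        d * Γ.edgeInner (fun _ _ ↦ 1) (fun _ _ ↦ 1) := by
      rw [← edgeInner_smul_left]
      refine edgeInner_congr (fun e ↦ (ae_restrict_iff' measurableSet_Icc).2
        (.of_forall fun x hx ↦ ?_)) (fun e ↦ .of_forall fun _ ↦ rfl)
      simp [hd e x hx]
    rw [hmean] at h1
    exact (mul_eq_zero.1 h1.symm).resolve_right hL.ne'
  have hfne : ¬∀ e, ∀ x ∈ Icc (Γ.left e) (Γ.right e), f e x = 0 := by
    intro h0
    have h1 : Γ.edgeInner f f = Γ.edgeInner (fun _ _ ↦ 0) (fun _ _ ↦ 0) := by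
      have : ∀ e, ∀ᵐ x ∂volume.restrict (Icc (Γ.left e) (Γ.right e)), f e x = 0 :=
        fun e ↦ (ae_restrict_iff' measurableSet_Icc).2 (.of_forall (h0 e))
      exact edgeInner_congr this this
    rw [hnorm] at h1
    simp [edgeInner] at h1
  have hcpos : 0 < c := by
    refine lt_of_le_of_ne (edgeInner_self_nonneg g) fun h0 ↦ hfne ?_
    obtain ⟨d, hd⟩ := hΓ.exists_eq_const hfg h0.symm
    have := hconst hd
    rwa [this] at hd
  have hof : Γ.ofEdges f ≠ 0 := by
    intro h0
    exact hfne fun e x hx ↦ congrFun (congrFun h0 e) ⟨x, hx⟩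
  have heig : Γ.IsEigenfunction c (Γ.ofEdges f) := isEigenfunction_of_weak hof hfg
    fun h k hhk ↦ weak_eigenfunction_of_minimizer hfg hmean (by rw [hnorm, mul_one]) hmin hhk
  have hleast : IsLeast (Γ.eigenvalueBounds 1) c := by
    constructor
    · refine ⟨![Γ.ofEdges fun _ _ ↦ 1, Γ.ofEdges f], ?_, ?_⟩
      · rw [LinearIndependent.pair_iff]
        intro s t hst
        have hpt : ∀ e, ∀ x ∈ Icc (Γ.left e) (Γ.right e), s + t * f e x = 0 := by
          intro e x hx
          have := congrFun (congrFun hst e) ⟨x, hx⟩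
          simpa [ofEdges] using this
        have ht : t = 0 := by
          by_contra ht
          have hd : ∀ e, ∀ x ∈ Icc (Γ.left e) (Γ.right e), f e x = -s / t := by
            intro e x hx
            rw [eq_div_iff ht]
            linarith [hpt e x hx]
          have := hconst hd
          rw [this] at hd
          exact hfne hd
        obtain ⟨e⟩ := hΓ.nonempty_edges
        have := hpt e _ (left_mem_Icc.2 (left_le_right e))
        rw [ht, zero_mul, add_zero] at this
        exact ⟨this, ht⟩
      · intro i
        fin_cases i
        · exact ⟨0, hcpos.le, isEigenfunction_const⟩
        · exact ⟨c, le_rfl, heig⟩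
    -- Eigenfunctions for 0 are constants, so two independent ones cannot both belong to 0. One with
    -- nonzero eigenvalue has mean value zero, and its eigenvalue is its Rayleigh quotient, hence at
    -- least `c`.
    · rintro t ⟨φ, hφ, hμ⟩
      have hex : ∃ i : Fin 2, ∃ μ ≤ t, μ ≠ 0 ∧ Γ.IsEigenfunction μ (φ i) := by
        by_contra! hno
        have hφc : ∀ i : Fin 2, ∃ d, ∀ e x, φ i e x = d := by
          intro i
          obtain ⟨μ, hμt, hμi⟩ := hμ i
          have hμ0 : μ = 0 := by
            by_contra h
            exact hno i μ hμt h hμi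
          subst hμ0
          have hQ := hμi.edgeInner_deriv hμi.inFormDomain
          rw [zero_mul] at hQ
          obtain ⟨d, hd⟩ := hΓ.exists_eq_const hμi.inFormDomain hQ
          exact ⟨d, fun e x ↦ by rw [← hd e x x.2, onEdge_apply]⟩
        obtain ⟨d₀, hd₀⟩ := hφc 0
        obtain ⟨d₁, hd₁⟩ := hφc 1
        have hpair : ∀ s t : ℝ, s • φ 0 + t • φ 1 = 0 → s = 0 ∧ t = 0 := by
          rw [← LinearIndependent.pair_iff]
          convert! hφ using 1
          ext i
          fin_cases i <;> rfl
        -- The relation `d₁ • φ 0 - d₀ • φ 1 = 0` between two constants forces `d₀ = 0`, so `φ 0`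
        -- vanishes, again contradicting independence.
        have h1 := hpair d₁ (-d₀) (by
          ext e x
          simp only [Pi.add_apply, Pi.smul_apply, smul_eq_mul, hd₀, hd₁, Pi.zero_apply]
          ring)
        have h2 := hpair 1 0 (by
          ext e x
          simp [hd₀, neg_eq_zero.1 h1.2])
        exact one_ne_zero h2.1
      obtain ⟨i, μ, hμt, hμ0, hμi⟩ := hex
      refine le_trans ?_ hμt
      have h1 := hmin _ _ hμi.inFormDomain (hμi.edgeInner_one hμ0)
      rw [hμi.edgeInner_deriv hμi.inFormDomain] at h1
      exact le_of_mul_le_mul_right h1 hμi.edgeInner_self_pos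
  have hval : Γ.eigenvalue 1 = c := hleast.csInf_eq
  rw [hval]
  exact ⟨hleast, hcpos, ⟨_, heig⟩, hmin⟩

end Spectrum

end MetricGraph

/-! ### Cutting and gluing -/

namespace MetricGraph

variable {V E : Type*} {Γ : MetricGraph V E}

theorem ofEdges_ne_zero_of_edgeInner_pos [Fintype E] {f : E → ℝ → ℝ} (h : 0 < Γ.edgeInner f f) :
    Γ.ofEdges f ≠ 0 := by
  intro h0
  have h1 : ∀ e, ∀ᵐ x ∂volume.restrict (Icc (Γ.left e) (Γ.right e)), f e x = 0 :=
    fun e ↦ (ae_restrict_iff' measurableSet_Icc).2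
      (.of_forall fun x hx ↦ congrFun (congrFun h0 e) ⟨x, hx⟩)
  rw [edgeInner_congr (u' := fun _ _ ↦ 0) (v' := fun _ _ ↦ 0) h1 h1] at h
  simp [edgeInner] at h

/-- The restrictions of the functions `u e` to the edges of a graph obtained by cutting `e₀`. -/
def cutFun (e₀ : E) (u : E → ℝ → ℝ) : Option E → ℝ → ℝ
  | some e => u e
  | none => u e₀

theorem cutFun_const (e₀ : E) (c : ℝ) : cutFun e₀ (fun _ _ ↦ c) = fun _ _ ↦ c := by
  ext e y
  cases e <;> rfl

variable [DecidableEq E] {e₀ : E} {x : ℝ} {hx : x ∈ Ioo (Γ.left e₀) (Γ.right e₀)}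

theorem edgeInner_cutFun [Fintype E] {u v : E → ℝ → ℝ} (hu : Γ.SquareIntegrable u)
    (hv : Γ.SquareIntegrable v) :
    (Γ.cut e₀ x hx).edgeInner (cutFun e₀ u) (cutFun e₀ v) = Γ.edgeInner u v := by
  have hi := intervalIntegrable_mul_of_memLp_two (left_le_right e₀) (hu e₀) (hv e₀)
  have hadj := intervalIntegral.integral_add_adjacent_intervals
    (hi.mono_set (c := Γ.left e₀) (d := x) (by
      rw [uIcc_of_le hx.1.le, uIcc_of_le (left_le_right e₀)]
      exact Icc_subset_Icc_right hx.2.le))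
    (hi.mono_set (c := x) (d := Γ.right e₀) (by
      rw [uIcc_of_le hx.2.le, uIcc_of_le (left_le_right e₀)]
      exact Icc_subset_Icc_left hx.1.le))
  rw [edgeInner, edgeInner, Fintype.sum_option,
    ← Finset.add_sum_erase _ _ (Finset.mem_univ e₀),
    ← Finset.add_sum_erase (s := Finset.univ)
      (f := fun e ↦ ∫ y in Γ.left e..Γ.right e, u e y * v e y) (a := e₀) (Finset.mem_univ e₀),
    ← hadj, ← add_assoc]
  congr 1
  · simp only [cut, cutFun, if_true]
    ring
  · refine Finset.sum_congr rfl fun e he ↦ ?_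
    simp only [cut, cutFun, if_neg (Finset.ne_of_mem_erase he)]

/-- Both new end points carry the value `f e₀ x`, and the old vertices keep theirs; so the values at
end points factor through the vertices of the cut graph. -/
theorem InFormDomain.cut {f g : E → ℝ → ℝ} (hfg : Γ.InFormDomain f g) :
    (Γ.cut e₀ x hx).InFormDomain (cutFun e₀ f) (cutFun e₀ g) := by
  constructor
  · rintro (_ | e)
    · exact (hfg.weakDeriv e₀).mono hx.1.le hx.2.le le_rfl
    · by_cases he : e = e₀
      · subst he
        simp only [MetricGraph.cut, cutFun, if_true]
        exact (hfg.weakDeriv e).mono le_rfl hx.1.le hx.2.le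
      · simp only [MetricGraph.cut, cutFun, if_neg he]
        exact hfg.weakDeriv e
  · let vertexValue : V → ℝ := fun v ↦
      f (Function.surjInv Γ.vert_surjective v).1 (Γ.coord (Function.surjInv Γ.vert_surjective v))
    have hvv : ∀ p, f p.1 (Γ.coord p) = vertexValue (Γ.vert p) := fun p ↦
      hfg.continuous _ _ (Function.surjInv_eq Γ.vert_surjective (Γ.vert p)).symm
    have hval : ∀ p, cutFun e₀ f p.1 ((Γ.cut e₀ x hx).coord p) =
        Sum.elim vertexValue (fun _ ↦ f e₀ x) ((Γ.cut e₀ x hx).vert p) := by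
      rintro ⟨_ | e, _ | _⟩
      · rfl
      · exact hvv (e₀, true)
      · exact hvv (e, false)
      · by_cases he : e = e₀
        · subst he
          simp [MetricGraph.cut, coord, cutFun]
        · simpa [MetricGraph.cut, coord, cutFun, he] using hvv (e, true)
    intro p q hpq
    rw [hval, hval, hpq]

/-- The converse of `cutFun`: the functions on the two halves of the edge `e₀` are joined. -/
noncomputable def glueFun (e₀ : E) (x : ℝ) (u : Option E → ℝ → ℝ) : E → ℝ → ℝ :=
  fun e y ↦ if e = e₀ ∧ x < y then u none y else u (some e) y

/-- Only the left end of the second piece can fail: at `x` the glued function takes the value from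
the first piece. -/
theorem cutFun_glueFun_ae (u : Option E → ℝ → ℝ) (e : Option E) :
    ∀ᵐ y ∂volume.restrict (Icc ((Γ.cut e₀ x hx).left e) ((Γ.cut e₀ x hx).right e)),
      cutFun e₀ (glueFun e₀ x u) e y = u e y := by
  rw [ae_restrict_iff' measurableSet_Icc]
  have hne : ∀ᵐ y : ℝ, y ≠ x := by simp [ae_iff, measure_singleton]
  filter_upwards [hne] with y hy hmem
  rcases e with _ | e
  · have hxy : x < y := lt_of_le_of_ne hmem.1 hy.symm
    simp [cutFun, glueFun, hxy]
  · by_cases he : e = e₀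
    · subst he
      have hyx : ¬x < y := by simpa [MetricGraph.cut] using hmem.2
      simp [cutFun, glueFun, hyx]
    · simp [cutFun, glueFun, he]

/-- Equality of the two values at `x` is what lets the integral identities on the two pieces combine
across the cut. -/
theorem InFormDomain.glue {f g : Option E → ℝ → ℝ} (hfg : (Γ.cut e₀ x hx).InFormDomain f g)
    (heq : f (some e₀) x = f none x) : Γ.InFormDomain (glueFun e₀ x f) (glueFun e₀ x g) := by
  constructor
  · intro e
    by_cases he : e = e₀
    · subst he
      have h1 := hfg.weakDeriv (some e)
      have h2 := hfg.weakDeriv none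
      have hae1 := cutFun_glueFun_ae (hx := hx) g (some e)
      have hae2 := cutFun_glueFun_ae (hx := hx) g none
      simp only [MetricGraph.cut, if_true, cutFun] at h1 h2 hae1 hae2
      refine HasWeakDeriv.union hx.1.le hx.2.le (h1.congr (fun y hy ↦ ?_) hae1)
        (h2.congr (fun y hy ↦ ?_) hae2)
      · simp [glueFun, not_lt.2 hy.2]
      · rcases hy.1.eq_or_lt with rfl | hxy
        · simpa [glueFun] using heq
        · simp [glueFun, hxy]
    · have h1 := hfg.weakDeriv (some e)
      simp only [MetricGraph.cut, if_neg he] at h1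
      have hg : ∀ u, glueFun e₀ x u e = u (some e) := fun u ↦ by
        ext y
        simp [glueFun, he]
      rwa [hg, hg]
  -- Every old end point survives in the cut graph at the same vertex; the right end of `e₀` becomes
  -- that of the second piece.
  · have hlift : ∀ p : E × Bool, ∃ q, (Γ.cut e₀ x hx).vert q = Sum.inl (Γ.vert p) ∧
        glueFun e₀ x f p.1 (Γ.coord p) = f q.1 ((Γ.cut e₀ x hx).coord q) := by
      rintro ⟨e, _ | _⟩
      · refine ⟨(some e, false), rfl, ?_⟩
        by_cases he : e = e₀
        · subst he
          simp [glueFun, coord, MetricGraph.cut, not_lt.2 hx.1.le]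
        · simp [glueFun, coord, MetricGraph.cut, he]
      · by_cases he : e = e₀
        · subst he
          exact ⟨(none, true), rfl, by simp [glueFun, coord, MetricGraph.cut, hx.2]⟩
        · exact ⟨(some e, true), by simp [MetricGraph.cut, he],
            by simp [glueFun, coord, MetricGraph.cut, he]⟩
    intro p q hpq
    obtain ⟨p', hp', hfp⟩ := hlift p
    obtain ⟨q', hq', hfq⟩ := hlift q
    rw [hfp, hfq]
    exact hfg.continuous _ _ (by rw [hp', hq', hpq])

variable [DecidableEq V] [Fintype E]

/-- The new vertex has degree one, so its Kirchhoff sum has a single term. -/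
theorem IsEigenfunction.deriv₁_eq_zero_at_cut {c : ℝ} {φ : (Γ.cut e₀ x hx).Fun}
    (hφ : (Γ.cut e₀ x hx).IsEigenfunction c φ) :
    derivWithin ((Γ.cut e₀ x hx).onEdge φ (some e₀)) (Icc (Γ.left e₀) x) x = 0 := by
  have hK := hφ.inDomain.kirchhoff (Sum.inr false)
  have hfilter : (Finset.univ.filter fun p ↦ (Γ.cut e₀ x hx).vert p = Sum.inr false) =
      {(some e₀, true)} := by
    ext ⟨e, i⟩
    rw [Finset.mem_filter, Finset.mem_singleton]
    rcases e with _ | e <;> cases i <;> simp [MetricGraph.cut]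
  rw [hfilter, Finset.sum_singleton] at hK
  simpa [normalDeriv, deriv₁, MetricGraph.cut] using hK

theorem eigenvalue_one_cut_le (hΓ : Γ.IsConnected) (hcut : (Γ.cut e₀ x hx).IsConnected) :
    (Γ.cut e₀ x hx).eigenvalue 1 ≤ Γ.eigenvalue 1 := by
  obtain ⟨-, hpos, ⟨ψ, hψ⟩, -⟩ := hΓ.eigenvalue_one
  obtain ⟨-, -, -, hmin⟩ := hcut.eigenvalue_one
  have hdom := hψ.inFormDomain
  have h1 : Γ.SquareIntegrable fun _ _ ↦ 1 := squareIntegrable_const 1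
  have hmean := hψ.edgeInner_one hpos.ne'
  rw [← edgeInner_cutFun (hx := hx) hdom.squareIntegrable h1, cutFun_const] at hmean
  have := hmin _ _ hdom.cut hmean
  rw [edgeInner_cutFun hdom.squareIntegrable hdom.squareIntegrable,
    edgeInner_cutFun hdom.squareIntegrable_deriv hdom.squareIntegrable_deriv,
    hψ.edgeInner_deriv hdom] at this
  exact le_of_mul_le_mul_right this hψ.edgeInner_self_pos

/-- With equal eigenvalues the cut eigenfunction attains the minimum on the cut graph, so it is an
eigenfunction there and satisfies the Neumann condition at the new vertex. -/
theorem hasDerivAt_zero_of_eigenvalue_one_cut_eq (hΓ : Γ.IsConnected)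
    (hcut : (Γ.cut e₀ x hx).IsConnected)
    (heq : (Γ.cut e₀ x hx).eigenvalue 1 = Γ.eigenvalue 1) {ψ : Γ.Fun}
    (hψ : Γ.IsEigenfunction (Γ.eigenvalue 1) ψ) : HasDerivAt (Γ.onEdge ψ e₀) 0 x := by
  obtain ⟨-, hpos, -, -⟩ := hΓ.eigenvalue_one
  obtain ⟨-, -, -, hmin⟩ := hcut.eigenvalue_one
  have := hcut.nonempty_edges
  have hdom := hψ.inFormDomain
  have h1 : Γ.SquareIntegrable fun _ _ ↦ 1 := squareIntegrable_const 1
  have hmean := hψ.edgeInner_one hpos.ne'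
  rw [← edgeInner_cutFun (hx := hx) hdom.squareIntegrable h1, cutFun_const] at hmean
  have hQ := hψ.edgeInner_deriv hdom
  rw [← heq, ← edgeInner_cutFun (hx := hx) hdom.squareIntegrable hdom.squareIntegrable,
    ← edgeInner_cutFun (hx := hx) hdom.squareIntegrable_deriv hdom.squareIntegrable_deriv] at hQ
  have hnz := hψ.edgeInner_self_pos
  rw [← edgeInner_cutFun (hx := hx) hdom.squareIntegrable hdom.squareIntegrable] at hnz
  have hφ := isEigenfunction_of_weak (ofEdges_ne_zero_of_edgeInner_pos hnz) hdom.cut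
    fun h k hhk ↦ weak_eigenfunction_of_minimizer hdom.cut hmean hQ hmin hhk
  have hx' : x ∈ Icc (Γ.left e₀) x := right_mem_Icc.2 hx.1.le
  have heqOn : EqOn ((Γ.cut e₀ x hx).onEdge
      ((Γ.cut e₀ x hx).ofEdges (cutFun e₀ (Γ.onEdge ψ))) (some e₀)) (Γ.onEdge ψ e₀)
      (Icc (Γ.left e₀) x) := by
    have := onEdge_ofEdges (Γ := Γ.cut e₀ x hx) (f := cutFun e₀ (Γ.onEdge ψ)) (some e₀)
    simpa [MetricGraph.cut, cutFun] using this
  have hzero := hφ.deriv₁_eq_zero_at_cut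
  rw [derivWithin_congr heqOn (heqOn hx')] at hzero
  -- On the uncut edge `x` is interior, so the two-sided derivative exists and equals the left one,
  -- which is zero.
  have hd : HasDerivAt (Γ.onEdge ψ e₀) (deriv (Γ.onEdge ψ e₀) x) x :=
    ((hψ.inDomain.sobolev e₀).differentiableOn.differentiableAt
      (Icc_mem_nhds hx.1 hx.2)).hasDerivAt
  rw [hd.hasDerivWithinAt.derivWithin (uniqueDiffOn_Icc hx.1 x hx')] at hzero
  rwa [hzero] at hd

/-- The glued eigenfunction is a trial function of mean value zero on the original graph, with the
same norm and energy. -/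
theorem eigenvalue_one_le_cut_of_endValue_eq (hΓ : Γ.IsConnected)
    (hcut : (Γ.cut e₀ x hx).IsConnected) {ψ : (Γ.cut e₀ x hx).Fun}
    (hψ : (Γ.cut e₀ x hx).IsEigenfunction ((Γ.cut e₀ x hx).eigenvalue 1) ψ)
    (hval : (Γ.cut e₀ x hx).endValue ψ (some e₀, true) =
      (Γ.cut e₀ x hx).endValue ψ (none, false)) :
    Γ.eigenvalue 1 ≤ (Γ.cut e₀ x hx).eigenvalue 1 := by
  obtain ⟨-, -, -, hmin⟩ := hΓ.eigenvalue_one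
  obtain ⟨-, hpos, -, -⟩ := hcut.eigenvalue_one
  have hdom := hψ.inFormDomain
  have hglue := hdom.glue (by simpa [endValue, coord, MetricGraph.cut] using hval)
  have hinner : ∀ u v : Option E → ℝ → ℝ, Γ.SquareIntegrable (glueFun e₀ x u) →
      Γ.SquareIntegrable (glueFun e₀ x v) →
      Γ.edgeInner (glueFun e₀ x u) (glueFun e₀ x v) = (Γ.cut e₀ x hx).edgeInner u v := by
    intro u v hu hv
    rw [← edgeInner_cutFun (hx := hx) hu hv]
    exact edgeInner_congr (cutFun_glueFun_ae u) (cutFun_glueFun_ae v)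
  have hone : glueFun e₀ x (fun _ _ ↦ 1) = fun _ _ ↦ 1 := by
    ext e y
    simp [glueFun]
  have h1 : Γ.SquareIntegrable (glueFun e₀ x fun _ _ ↦ 1) := by
    rw [hone]
    exact squareIntegrable_const 1
  have hmean := hψ.edgeInner_one hpos.ne'
  rw [← hinner _ _ hglue.squareIntegrable h1, hone] at hmean
  have := hmin _ _ hglue hmean
  rw [hinner _ _ hglue.squareIntegrable hglue.squareIntegrable,
    hinner _ _ hglue.squareIntegrable_deriv hglue.squareIntegrable_deriv,
    hψ.edgeInner_deriv hdom] at this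
  exact le_of_mul_le_mul_right this hψ.edgeInner_self_pos

end MetricGraph

theorem theorem5 {V E : Type*} [DecidableEq V] [Fintype E] [DecidableEq E]
    (Γ : MetricGraph V E) (hΓ : Γ.IsConnected)
    (e₀ : E) (x : ℝ) (hx : x ∈ Set.Ioo (Γ.left e₀) (Γ.right e₀))
    (hcut : (Γ.cut e₀ x hx).IsConnected) :
    -- the first excited eigenvalues of both graphs exist
    IsLeast (Γ.eigenvalueBounds 1) (Γ.eigenvalue 1) ∧
    IsLeast ((Γ.cut e₀ x hx).eigenvalueBounds 1) ((Γ.cut e₀ x hx).eigenvalue 1) ∧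
    -- cutting does not increase the first excited eigenvalue
    (Γ.cut e₀ x hx).eigenvalue 1 ≤ Γ.eigenvalue 1 ∧
    -- equality forces the Neumann condition at the cut point
    ((Γ.cut e₀ x hx).eigenvalue 1 = Γ.eigenvalue 1 →
      ∀ ψ : Γ.Fun, Γ.IsEigenfunction (Γ.eigenvalue 1) ψ → HasDerivAt (Γ.onEdge ψ e₀) 0 x) ∧
    -- equal values at the two new vertices force equality
    ((∃ ψ : (Γ.cut e₀ x hx).Fun,
        (Γ.cut e₀ x hx).IsEigenfunction ((Γ.cut e₀ x hx).eigenvalue 1) ψ ∧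
        (Γ.cut e₀ x hx).endValue ψ (some e₀, true) = (Γ.cut e₀ x hx).endValue ψ (none, false)) →
      (Γ.cut e₀ x hx).eigenvalue 1 = Γ.eigenvalue 1) := by
  refine ⟨hΓ.eigenvalue_one.1, hcut.eigenvalue_one.1, MetricGraph.eigenvalue_one_cut_le hΓ hcut,
    fun heq ψ hψ ↦ MetricGraph.hasDerivAt_zero_of_eigenvalue_one_cut_eq hΓ hcut heq hψ, ?_⟩
  rintro ⟨ψ, hψ, hval⟩
  exact (MetricGraph.eigenvalue_one_cut_le hΓ hcut).antisymm
    (MetricGraph.eigenvalue_one_le_cut_of_endValue_eq hΓ hcut hψ hval)
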